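/- An odd Durfee symbol of a positive integer $N$ consists of an integer $D\ge 0$ and two finite, possibly empty, non-increasing rows $a_1\ge\cdots\ge a_s$ and $b_1\ge\cdots\ge b_t$ of odd positive integers, all at most $2D+1$, such that $$N=\sum_{i=1}^s a_i+\sum_{j=1}^t b_j+2D^2+2D+1.$$ Its odd rank is $s-t$. Let $N^0(a,M;N)$ denote the number of odd Durfee symbols of $N$ whose odd rank is congruent to $a$ modulo $M$. Let $p_\omega(n)$ denote the number of partitions of $n$ in which, after one instance of the largest part is removed, the remaining parts can be grouped into pairs $(i+1,i)$ of consecutive non-negative integers (each of which may be used repeatedly, the pair $(1,0)$ amounting to a single part $1$). Then for every integer $n\ge 1$, $$N^0(0,8;16n-5)-N^0(4,8;16n-5)=p_\omega(n).$$ -/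

import Mathlib

/-- An odd Durfee symbol of `n`: two finite non-increasing rows of odd positive integers (given by
their multisets of entries, possibly empty), with all entries at most `2 * D + 1`, where the
subscript is `D`, and with `n = (sum of all entries) + 2 * D ^ 2 + 2 * D + 1`. -/
@[ext]
structure OddDurfeeSymbol (n : ℕ) where
  top : Multiset ℕ
  bottom : Multiset ℕ
  D : ℕ
  top_odd : ∀ a ∈ top, Odd a
  top_le : ∀ a ∈ top, a ≤ 2 * D + 1
  bottom_odd : ∀ b ∈ bottom, Odd b
  bottom_le : ∀ b ∈ bottom, b ≤ 2 * D + 1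
  weight : n = top.sum + bottom.sum + 2 * D ^ 2 + 2 * D + 1

namespace OddDurfeeSymbol

/-- The odd rank: number of entries in the top row minus number of entries in the bottom row. -/
def oddRank {n : ℕ} (σ : OddDurfeeSymbol n) : ℤ :=
  (Multiset.card σ.top : ℤ) - (Multiset.card σ.bottom : ℤ)

/-- There are only finitely many odd Durfee symbols of `n`, so that `Nat.card` below counts. -/
instance instFinite (n : ℕ) : Finite (OddDurfeeSymbol n) := by
  let f : OddDurfeeSymbol n →
      (Σ k : Fin (n + 1), (k : ℕ).Partition) × (Σ k : Fin (n + 1), (k : ℕ).Partition) ×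
        Fin (n + 1) := fun σ =>
    (⟨⟨σ.top.sum, by have := σ.weight; omega⟩, ⟨σ.top, fun h => (σ.top_odd _ h).pos, rfl⟩⟩,
     ⟨⟨σ.bottom.sum, by have := σ.weight; omega⟩,
        ⟨σ.bottom, fun h => (σ.bottom_odd _ h).pos, rfl⟩⟩,
     ⟨σ.D, by have := σ.weight; omega⟩)
  refine Finite.of_injective f fun σ τ h => ?_
  have h1 := congrArg (fun x => x.1.2.parts) h
  have h2 := congrArg (fun x => x.2.1.2.parts) h
  have h3 := congrArg (fun x => (x.2.2 : ℕ)) h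
  exact OddDurfeeSymbol.ext h1 h2 h3

end OddDurfeeSymbol

/-- `N⁰(a, M; n)`: the number of odd Durfee symbols of `n` with odd rank congruent to `a`
modulo `M`. -/
noncomputable def oddRankCount (a M : ℤ) (n : ℕ) : ℕ :=
  Nat.card {σ : OddDurfeeSymbol n // σ.oddRank ≡ a [ZMOD M]}

/-- After removal of one instance of the largest part `L`, the remaining parts can be grouped into
pairs `(i + 1, i)` of consecutive non-negative integers, where the pair `(1, 0)` stands for a single
part `1`. The multiset `s` lists the smaller members `i` of the pairs; zeros are discarded. -/
def IsOmegaPartition {n : ℕ} (π : n.Partition) : Prop :=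
  ∃ L ∈ π.parts, (∀ p ∈ π.parts, p ≤ L) ∧
    ∃ s : Multiset ℕ, π.parts.erase L = (s.map (fun i => i + 1) + s).filter (fun p => 0 < p)

/-- `p_ω(n)`: the number of partitions of `n` all of whose parts, except for one instance of the
largest part, are grouped into pairs of consecutive non-negative integers. -/
noncomputable def pOmega (n : ℕ) : ℕ :=
  Nat.card {π : n.Partition // IsOmegaPartition π}

/-! Let `z` satisfy `z² = i`. For odd `N` every odd rank is even, and the real part of `z^rank` is
1, -1 or 0 according as the rank is 0, 4 or ±2 modulo 8. The left side is therefore the real part of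
the rank generating function at `z`, and the task is to find its coefficient at `q^(16n-5)`.

Put `u = z + z⁻¹`, so `u² = 2`. The generating function is `q ∑_D q^(2D(D+1)) / ∏_{l≤D} (1 - u
q^(2l+1) + q^(4l+2))`. A limiting Watson–Whipple transformation (`watson_whipple`) turns the sum
into `(q²;q²)_∞⁻¹` times the Lambert-type sum `lambertSum 6 u`. Since `(1 - ua + a²)(1 + ua + a²) =
1 + a⁴`, its even part is `mockNuQuartic` at `q²` (`lambertSum_six_even_part`), so the coefficient
wanted is that of `q^(8m+5)` in `mockNuQuartic`, with `m = n - 1`.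

The remaining input is `appell_relation`. Expanding `1 / ∏ (1 - u q^(2l+1) + q^(4l+2))(1 + u
q^(4l+2) + q^(8l+4))` in partial fractions in `u` links `lambertSum 3 u` at `q` with `lambertSum 6
(-u)` at `q²`. At `u = -2` it gives ν(q) = (series in q²) - q ω(q²). At `u = 0` it gives
`mockNuQuartic` = θ(q) F(q⁸) - q ν(q⁴), where θ(q) is the sum of `q^(j²)` over all integers `j`. No
square is 5 modulo 8, so at exponents `8m + 5` only `-q ν(q⁴)` contributes, and its coefficient is
that of `q^m` in ω (`coeff_mockNuQuartic`).

Finally ω(q) = ∑ qⁿ/(q;q²)_{n+1} (`mockOmega_lim`). The index gives the largest part `n + 1`, up to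
one factor `q`, and a factor `1 - q^(2i+1)` accounts for the pairs `(i+1, i)`; hence its
coefficients are those of p_ω (`coeff_mockOmega`).

The analytic identities are proved first as finite rational identities, then passed to `X`-adic
limits. -/

open PowerSeries Filter Finset

/-! ### `X`-adic limits, infinite sums and infinite products. -/

variable {R : Type*} [CommRing R] {k : Type*} [Field k]

/-- Convergence of a sequence of formal power series in the `X`-adic topology. -/
def XAdicLim (f : ℕ → R⟦X⟧) (g : R⟦X⟧) : Prop :=
  ∀ d : ℕ, ∀ᶠ n in atTop, (X : R⟦X⟧) ^ d ∣ f n - g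

namespace XAdicLim

theorem const (g : R⟦X⟧) : XAdicLim (fun _ => g) g := fun d => by simp

theorem coeff_eventually {f : ℕ → R⟦X⟧} {g : R⟦X⟧} (h : XAdicLim f g) (d : ℕ) :
    ∀ᶠ n in atTop, coeff d (f n) = coeff d g := by
  filter_upwards [h (d + 1)] with n hn
  have := X_pow_dvd_iff.1 hn d (Nat.lt_succ_self d)
  rwa [map_sub, sub_eq_zero] at this

theorem unique {f : ℕ → R⟦X⟧} {g g' : R⟦X⟧} (h : XAdicLim f g) (h' : XAdicLim f g') :
    g = g' := by
  ext d
  obtain ⟨n, h1, h2⟩ := ((h.coeff_eventually d).and (h'.coeff_eventually d)).exists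
  rw [← h1, h2]

theorem congr' {f f' : ℕ → R⟦X⟧} {g : R⟦X⟧} (h : XAdicLim f g) (hf : ∀ᶠ n in atTop, f n = f' n) :
    XAdicLim f' g := fun d => by
  filter_upwards [h d, hf] with n h1 h2
  rwa [← h2]

theorem comp {f : ℕ → R⟦X⟧} {g : R⟦X⟧} (h : XAdicLim f g) {φ : ℕ → ℕ}
    (hφ : Tendsto φ atTop atTop) : XAdicLim (fun n => f (φ n)) g :=
  fun d => hφ.eventually (h d)

theorem add {f f' : ℕ → R⟦X⟧} {g g' : R⟦X⟧} (h : XAdicLim f g) (h' : XAdicLim f' g') :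
    XAdicLim (fun n => f n + f' n) (g + g') := fun d => by
  filter_upwards [h d, h' d] with n h1 h2
  rw [add_sub_add_comm]
  exact dvd_add h1 h2

theorem mul {f f' : ℕ → R⟦X⟧} {g g' : R⟦X⟧} (h : XAdicLim f g) (h' : XAdicLim f' g') :
    XAdicLim (fun n => f n * f' n) (g * g') := fun d => by
  filter_upwards [h d, h' d] with n h1 h2
  rw [show f n * f' n - g * g' = (f n - g) * f' n + g * (f' n - g') by ring]
  exact dvd_add (h1.mul_right _) (h2.mul_left _)

theorem const_mul {f : ℕ → R⟦X⟧} {g : R⟦X⟧} (a : R⟦X⟧) (h : XAdicLim f g) :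
    XAdicLim (fun n => a * f n) (a * g) :=
  (const a).mul h

theorem mul_const {f : ℕ → R⟦X⟧} {g : R⟦X⟧} (h : XAdicLim f g) (a : R⟦X⟧) :
    XAdicLim (fun n => f n * a) (g * a) :=
  h.mul (const a)

theorem inv {f : ℕ → k⟦X⟧} {g : k⟦X⟧} (h : XAdicLim f g)
    (hf : ∀ n, constantCoeff (f n) ≠ 0) (hg : constantCoeff g ≠ 0) :
    XAdicLim (fun n => (f n)⁻¹) g⁻¹ := fun d => by
  filter_upwards [h d] with n h1
  have e1 := PowerSeries.mul_inv_cancel _ (hf n)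
  have e2 := PowerSeries.mul_inv_cancel _ hg
  have e3 : (f n)⁻¹ - g⁻¹ = (f n - g) * (-(f n)⁻¹ * g⁻¹) := by
    linear_combination g⁻¹ * e1 - (f n)⁻¹ * e2
  rw [e3]
  exact h1.mul_right _

theorem expand {f : ℕ → R⟦X⟧} {g : R⟦X⟧} (h : XAdicLim f g) (m : ℕ) (hm : m ≠ 0) :
    XAdicLim (fun n => PowerSeries.expand m hm (f n)) (PowerSeries.expand m hm g) := fun d => by
  filter_upwards [h d] with n h1
  obtain ⟨c, hc⟩ := h1
  rw [← map_sub, hc, map_mul, map_pow, expand_X, ← pow_mul]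
  exact ((pow_dvd_pow _ (Nat.le_mul_of_pos_left d (Nat.pos_of_ne_zero hm)))).mul_right _

theorem zero_of_dvd {f : ℕ → R⟦X⟧} (h : ∀ n, (X : R⟦X⟧) ^ n ∣ f n) : XAdicLim f 0 := fun d => by
  filter_upwards [eventually_ge_atTop d] with n hn
  rw [sub_zero]
  exact (pow_dvd_pow _ hn).trans (h n)

end XAdicLim

/-- The sum of a series whose `n`-th term is divisible by `X ^ n`. -/
noncomputable def infSum (a : ℕ → R⟦X⟧) : R⟦X⟧ :=
  PowerSeries.mk fun d => ∑ j ∈ range (d + 1), coeff d (a j)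

/-- The limit of a product whose `n`-th factor is congruent to `1` modulo `X ^ n`. -/
noncomputable def infProd (a : ℕ → R⟦X⟧) : R⟦X⟧ :=
  PowerSeries.mk fun d => coeff d (∏ j ∈ range (d + 1), a j)

/-- A Tannery-type theorem: as `X ^ j` divides the `j`-th summand, only finitely many summands
affect the coefficients below a given degree, so the limit may be taken termwise. -/
theorem XAdicLim.sum_of_dominated {a : ℕ → ℕ → R⟦X⟧} {b : ℕ → R⟦X⟧} {m : ℕ → ℕ}
    (hm : Tendsto m atTop atTop) (ha : ∀ n j, j < m n → (X : R⟦X⟧) ^ j ∣ a n j)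
    (h : ∀ j, XAdicLim (fun n => a n j) (b j)) :
    XAdicLim (fun n => ∑ j ∈ range (m n), a n j) (infSum b) := by
  intro d
  have h1 : ∀ᶠ n in atTop, ∀ j ∈ range d, ∀ i ∈ range d, coeff i (a n j) = coeff i (b j) := by
    rw [eventually_all_finset]
    intro j _
    rw [eventually_all_finset]
    exact fun i _ => (h j).coeff_eventually i
  filter_upwards [h1, hm.eventually_ge_atTop d] with n hn hmn
  rw [X_pow_dvd_iff]
  intro i hi
  rw [map_sub, sub_eq_zero, infSum, coeff_mk, map_sum]
  rw [← Finset.sum_subset (range_subset_range.2 (show i + 1 ≤ m n by omega))]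
  · refine Finset.sum_congr rfl fun j hj => hn j ?_ i ?_ <;> simp at * <;> omega
  · intro j hj hj'
    exact X_pow_dvd_iff.1 (ha n j (by simpa using hj)) i (by simp at hj'; omega)

theorem infSum_lim {a : ℕ → R⟦X⟧} (ha : ∀ j, (X : R⟦X⟧) ^ j ∣ a j) :
    XAdicLim (fun n => ∑ j ∈ range n, a j) (infSum a) :=
  XAdicLim.sum_of_dominated (a := fun _ => a) tendsto_id (fun _ j _ => ha j)
    fun _ => XAdicLim.const _

theorem infProd_lim {a : ℕ → R⟦X⟧} (ha : ∀ j, (X : R⟦X⟧) ^ j ∣ a j - 1) :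
    XAdicLim (fun n => ∏ j ∈ range n, a j) (infProd a) := by
  have key : ∀ d n, (X : R⟦X⟧) ^ d ∣ ∏ j ∈ range (d + n), a j - ∏ j ∈ range d, a j := by
    intro d n
    induction n with
    | zero => simp
    | succ n ih =>
      rw [← add_assoc, prod_range_succ]
      rw [show (∏ j ∈ range (d + n), a j) * a (d + n) - ∏ j ∈ range d, a j =
        (∏ j ∈ range (d + n), a j - ∏ j ∈ range d, a j)
          + (∏ j ∈ range (d + n), a j) * (a (d + n) - 1) by ring]
      exact dvd_add ih (((pow_dvd_pow _ (Nat.le_add_right _ _)).trans (ha _)).mul_left _)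
  intro d
  filter_upwards [eventually_ge_atTop d] with n hn
  rw [X_pow_dvd_iff]
  intro i hi
  rw [map_sub, sub_eq_zero, infProd, coeff_mk]
  obtain ⟨m, rfl⟩ := Nat.exists_eq_add_of_le (show i + 1 ≤ n by omega)
  have := X_pow_dvd_iff.1 (key (i + 1) m) i (Nat.lt_succ_self i)
  rwa [map_sub, sub_eq_zero] at this

theorem infSum_congr {a b : ℕ → R⟦X⟧} (h : ∀ j, a j = b j) : infSum a = infSum b := by
  rw [funext h]

theorem infSum_add (a b : ℕ → R⟦X⟧) : infSum (fun j => a j + b j) = infSum a + infSum b := by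
  ext d
  simp [infSum, sum_add_distrib]

theorem infSum_mul_left {a : ℕ → R⟦X⟧} (ha : ∀ j, (X : R⟦X⟧) ^ j ∣ a j) (c : R⟦X⟧) :
    infSum (fun j => c * a j) = c * infSum a := by
  refine (infSum_lim (fun j => (ha j).mul_left c)).unique ?_
  simp_rw [← mul_sum]
  exact (infSum_lim ha).const_mul c

theorem expand_infSum {a : ℕ → R⟦X⟧} (ha : ∀ j, (X : R⟦X⟧) ^ j ∣ a j) (m : ℕ) (hm : m ≠ 0) :
    PowerSeries.expand m hm (infSum a) = infSum fun j => PowerSeries.expand m hm (a j) := by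
  refine ((infSum_lim ha).expand m hm).unique ?_
  simp_rw [map_sum]
  refine infSum_lim fun j => ?_
  obtain ⟨c, hc⟩ := ha j
  rw [hc, map_mul, map_pow, expand_X, ← pow_mul]
  exact ((pow_dvd_pow _ (Nat.le_mul_of_pos_left j (Nat.pos_of_ne_zero hm)))).mul_right _

theorem infProd_mul {a b : ℕ → R⟦X⟧} (ha : ∀ j, (X : R⟦X⟧) ^ j ∣ a j - 1)
    (hb : ∀ j, (X : R⟦X⟧) ^ j ∣ b j - 1) :
    infProd (fun j => a j * b j) = infProd a * infProd b := by
  refine XAdicLim.unique (infProd_lim fun j => ?_) ?_ (f := fun n => ∏ j ∈ range n, (a j * b j))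
  · rw [show a j * b j - 1 = (a j - 1) * b j + (b j - 1) by ring]
    exact dvd_add ((ha j).mul_right _) (hb j)
  · simp_rw [prod_mul_distrib]
    exact (infProd_lim ha).mul (infProd_lim hb)

theorem expand_infProd {a : ℕ → R⟦X⟧} (ha : ∀ j, (X : R⟦X⟧) ^ j ∣ a j - 1) (m : ℕ) (hm : m ≠ 0) :
    PowerSeries.expand m hm (infProd a) = infProd fun j => PowerSeries.expand m hm (a j) := by
  refine ((infProd_lim ha).expand m hm).unique ?_
  simp_rw [map_prod]
  refine infProd_lim fun j => ?_
  obtain ⟨c, hc⟩ := ha j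
  rw [← map_one (PowerSeries.expand m hm), ← map_sub, hc, map_mul, map_pow, expand_X, ← pow_mul]
  exact ((pow_dvd_pow _ (Nat.le_mul_of_pos_left j (Nat.pos_of_ne_zero hm)))).mul_right _

theorem constantCoeff_infProd (a : ℕ → R⟦X⟧) :
    constantCoeff (infProd a) = constantCoeff (a 0) := by
  rw [← coeff_zero_eq_constantCoeff_apply, infProd, coeff_mk]
  simp

/-! ### `q`-Pochhammer symbols. -/

/-- The finite `q`-Pochhammer symbol `(c; p)_n`. -/
def qPoch {S : Type*} [CommRing S] (c p : S) (n : ℕ) : S :=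
  ∏ l ∈ range n, (1 - c * p ^ l)

/-- The infinite `q`-Pochhammer symbol `(c; p)_∞` for formal power series. -/
noncomputable def qPochInf (c p : R⟦X⟧) : R⟦X⟧ :=
  infProd fun l => 1 - c * p ^ l

theorem qPoch_succ {S : Type*} [CommRing S] (c p : S) (n : ℕ) :
    qPoch c p (n + 1) = qPoch c p n * (1 - c * p ^ n) :=
  prod_range_succ _ _

theorem qPoch_zero {S : Type*} [CommRing S] (c p : S) : qPoch c p 0 = 1 := prod_range_zero _

theorem map_qPoch {S S' : Type*} [CommRing S] [CommRing S'] (φ : S →+* S') (c p : S) (n : ℕ) :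
    φ (qPoch c p n) = qPoch (φ c) (φ p) n := by
  simp [qPoch]

theorem constantCoeff_qPoch {c : R⟦X⟧} (hc : constantCoeff c = 0) (p : R⟦X⟧) (n : ℕ) :
    constantCoeff (qPoch c p n) = 1 := by
  simp [qPoch, hc]

theorem constantCoeff_qPochInf {c : R⟦X⟧} (hc : constantCoeff c = 0) (p : R⟦X⟧) :
    constantCoeff (qPochInf c p) = 1 := by
  simp [qPochInf, constantCoeff_infProd, hc]

theorem X_pow_dvd_factor (c : R⟦X⟧) {p : R⟦X⟧} (hp : X ∣ p) (l : ℕ) :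
    (X : R⟦X⟧) ^ l ∣ (1 - c * p ^ l) - 1 := by
  rw [sub_sub_cancel_left, dvd_neg]
  exact (pow_dvd_pow_of_dvd hp l).mul_left c

theorem qPoch_lim (c : R⟦X⟧) {p : R⟦X⟧} (hp : X ∣ p) :
    XAdicLim (qPoch c p) (qPochInf c p) :=
  infProd_lim (X_pow_dvd_factor c hp)

theorem expand_qPochInf (c : R⟦X⟧) {p : R⟦X⟧} (hp : X ∣ p) (m : ℕ) (hm : m ≠ 0) :
    PowerSeries.expand m hm (qPochInf c p) =
      qPochInf (PowerSeries.expand m hm c) (PowerSeries.expand m hm p) := by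
  rw [qPochInf, expand_infProd (X_pow_dvd_factor c hp)]
  simp [qPochInf]

theorem qPochInf_mul_neg (c : R⟦X⟧) {p : R⟦X⟧} (hp : X ∣ p) :
    qPochInf c p * qPochInf (-c) p = qPochInf (c ^ 2) (p ^ 2) := by
  rw [qPochInf, qPochInf, ← infProd_mul (X_pow_dvd_factor c hp) (X_pow_dvd_factor (-c) hp)]
  congr 1
  ext1 l
  ring

theorem qPochInf_dissect (c : R⟦X⟧) {p : R⟦X⟧} (hp : X ∣ p) :
    qPochInf c p = qPochInf c (p ^ 2) * qPochInf (c * p) (p ^ 2) := by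
  have hp2 : X ∣ p ^ 2 := hp.trans (dvd_pow_self _ two_ne_zero)
  refine ((qPoch_lim c hp).comp (tendsto_id.const_mul_atTop' two_pos)).unique ?_
  refine ((qPoch_lim c hp2).mul (qPoch_lim (c * p) hp2)).congr' (.of_forall fun n => ?_)
  induction n with
  | zero => simp [qPoch]
  | succ n ih =>
    simp only [id] at ih ⊢
    rw [show 2 * (n + 1) = 2 * n + 1 + 1 by ring]
    simp only [qPoch_succ, ← ih]
    ring

/-! ### Finite partial fraction identities over a field. -/

/-- Partial fractions of `∏ (1 - u aᵢ + aᵢ²)⁻¹` as a function of `u`. -/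
theorem prod_inv_eq_sum_partial_fractions {K ι : Type*} [Field K] [DecidableEq ι] (s : Finset ι)
    (hs : s.Nonempty) (a : ι → K) (u : K) (h0 : ∀ i ∈ s, a i ≠ 0)
    (h1 : ∀ i ∈ s, ∀ j ∈ s, j ≠ i → 1 - a j / a i ≠ 0)
    (h2 : ∀ i ∈ s, ∀ j ∈ s, j ≠ i → 1 - a j * a i ≠ 0)
    (hd : ∀ i ∈ s, 1 - u * a i + a i ^ 2 ≠ 0) :
    ∏ i ∈ s, (1 - u * a i + a i ^ 2)⁻¹ = ∑ i ∈ s, (1 - u * a i + a i ^ 2)⁻¹ *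
      (∏ j ∈ s.erase i, ((1 - a j * a i) * (1 - a j / a i)))⁻¹ := by
  -- The `i`-th factor equals `-aᵢ (u - vᵢ)`, so the `vᵢ` are the poles in `u` and serve as
  -- interpolation nodes.
  set v : ι → K := fun i => a i + (a i)⁻¹ with hv
  have hdiff : ∀ i ∈ s, ∀ j ∈ s, j ≠ i →
      v i - v j = -((1 - a j * a i) * (1 - a j / a i)) / a j := by
    intro i hi j hj _
    have := h0 i hi
    have := h0 j hj
    simp only [hv]
    field_simp
    ring
  have hinj : Set.InjOn v s := by
    intro i hi j hj hij
    by_contra hne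
    have hne' : j ≠ i := fun h => hne h.symm
    have := hdiff i hi j hj hne'
    rw [hij, sub_self, eq_comm, div_eq_zero_iff, neg_eq_zero, mul_eq_zero] at this
    rcases this with (h | h) | h
    exacts [h2 i hi j hj hne' h, h1 i hi j hj hne' h, h0 j hj h]
  have key := congrArg (Polynomial.eval u) (Lagrange.sum_basis hinj hs)
  rw [Polynomial.eval_finsetSum, Polynomial.eval_one] at key
  -- The Lagrange basis polynomials sum to 1; multiplying this by the product of inverses cancels
  -- all factors but one in each summand.
  refine (mul_one _).symm.trans ((congrArg _ key.symm).trans ?_)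
  rw [mul_sum]
  refine sum_congr rfl fun i hi => ?_
  rw [Lagrange.basis, Polynomial.eval_prod, ← mul_prod_erase s _ hi, mul_assoc, ← prod_mul_distrib,
    ← prod_inv_distrib]
  congr 1
  refine prod_congr rfl fun j hj => ?_
  obtain ⟨hji, hj⟩ := mem_erase.1 hj
  simp only [Lagrange.basisDivisor, Polynomial.eval_mul, Polynomial.eval_sub, Polynomial.eval_C,
    Polynomial.eval_X]
  rw [hdiff i hi j hj hji]
  have e1 := h0 j hj
  have e2 := h1 i hi j hj hji
  have e3 := h2 i hi j hj hji
  have e4 := hd j hj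
  have e5 : u - v j = -(1 - u * a j + a j ^ 2) / a j := by
    simp only [hv]
    field_simp
    ring
  rw [e5]
  field_simp

theorem prod_erase_range {K : Type*} [CommMonoid K] (f : ℕ → K) (k m : ℕ) :
    ∏ l ∈ (range (k + 1 + m)).erase k, f l =
      (∏ l ∈ range k, f l) * ∏ j ∈ range m, f (k + 1 + j) := by
  induction m with
  | zero =>
    rw [add_zero, range_add_one, erase_insert notMem_range_self, prod_range_zero, mul_one]
  | succ m ih =>
    rw [← add_assoc, range_add_one, erase_insert_of_ne (by omega), prod_insert (by simp), ih,
      prod_range_succ, mul_comm, mul_assoc]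

theorem qPoch_add {S : Type*} [CommRing S] (c p : S) (m n : ℕ) :
    qPoch c p (m + n) = qPoch c p m * ∏ l ∈ range n, (1 - c * p ^ (m + l)) :=
  prod_range_add _ _ _

theorem choose_two_succ (k : ℕ) : (k + 1).choose 2 = k.choose 2 + k := by
  rw [Nat.choose_succ_succ' k 1, Nat.choose_one_right, add_comm]

theorem prod_pow_id {S : Type*} [CommMonoid S] (p : S) (k : ℕ) :
    ∏ l ∈ range k, p ^ l = p ^ k.choose 2 := by
  induction k with
  | zero => simp
  | succ k ih => rw [prod_range_succ, ih, choose_two_succ, pow_add]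

variable {K : Type*} [Field K]

/-- Reversing the order of the factors gives `1 + (c p^l)⁻¹`, and `c p^l` is pulled out of each
denominator. -/
theorem prod_one_add_div_pow {c d p : K} (hp : p ≠ 0) (hc : c ≠ 0) (hcd : c * d = p) (r : ℕ) :
    ∏ l ∈ range r, (1 + p ^ l * d / p ^ r) =
      (c ^ r * p ^ r.choose 2)⁻¹ * qPoch (-c) p r := by
  have e : (∏ l ∈ range r, (c * p ^ l)) = c ^ r * p ^ r.choose 2 := by
    rw [prod_mul_distrib, prod_pow_id, prod_const, card_range]
  rw [← e, ← prod_inv_distrib, qPoch, ← prod_mul_distrib, ← prod_range_reflect]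
  refine prod_congr rfl fun l hl => ?_
  rw [mem_range] at hl
  obtain ⟨m, rfl⟩ := Nat.exists_eq_add_of_lt hl
  rw [show l + m + 1 - 1 - l = m by omega, show l + m + 1 = l + 1 + m by ring, pow_add, pow_succ]
  have hd : d = p / c := by field_simp; linear_combination hcd
  rw [hd]
  field_simp
  ring

/-- A theta product shifted by `r` steps. -/
theorem prod_shift_mul_prod_shift {c d p : K} (hp : p ≠ 0) (hc : c ≠ 0) (hcd : c * d = p)
    {r N : ℕ} (hr : r ≤ N) :
    ∏ l ∈ range N, ((1 + p ^ (l + r) * c) * (1 + p ^ l * d / p ^ r)) =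
      (c ^ r * p ^ r.choose 2)⁻¹ * (qPoch (-c) p (N + r) * qPoch (-d) p (N - r)) := by
  obtain ⟨m, rfl⟩ := Nat.exists_eq_add_of_le hr
  rw [prod_mul_distrib, prod_range_add (fun l => 1 + p ^ l * d / p ^ r),
    prod_one_add_div_pow hp hc hcd, Nat.add_sub_cancel_left, add_comm (r + m) r, qPoch_add]
  have e1 : ∀ l, 1 + p ^ (r + l) * d / p ^ r = 1 - -d * p ^ l := by
    intro l
    rw [pow_add]
    field_simp
    ring
  have e2 : ∀ l, 1 + p ^ (l + r) * c = 1 - -c * p ^ (r + l) := by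
    intro l
    rw [add_comm l]
    ring
  simp_rw [e1, e2]
  rw [qPoch, qPoch]
  ring

/-- This evaluates the residue weight at node `k`. The factors `1 - p^(l+k+1)` complete to
`(p;p)_{M+k}` once `(p;p)_k` and the omitted `1 - p^(2k+1)` are supplied. The factors `1 - p^(l-k)`
give `(p;p)_{M-1-k}` for `l > k` and, up to sign and a power of `p`, another `(p;p)_k` for `l < k`,
which cancels. -/
theorem prod_erase_eq {p : K} (hp : p ≠ 0) (hp1 : ∀ n, 0 < n → p ^ n ≠ 1) {k M : ℕ} (hk : k < M) :
    ∏ l ∈ (range M).erase k, ((1 - p ^ (l + k + 1)) * (1 - p ^ l / p ^ k)) =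
      (-1) ^ k * (p ^ (k + 1).choose 2)⁻¹ * (1 - p ^ (2 * k + 1))⁻¹ *
        (qPoch p p (M + k) * qPoch p p (M - 1 - k)) := by
  obtain ⟨m, rfl⟩ := Nat.exists_eq_add_of_lt hk
  rw [show k + m + 1 = k + 1 + m by ring, prod_mul_distrib,
    prod_erase_range (fun l => 1 - p ^ l / p ^ k), prod_erase_range,
    show k + 1 + m - 1 - k = m by omega]
  have e1 : ∏ l ∈ range k, (1 - p ^ l / p ^ k) =
      (-1) ^ k * (p ^ (k + 1).choose 2)⁻¹ * qPoch p p k := by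
    have e : (-1) ^ k * (p ^ (k + 1).choose 2)⁻¹ = ∏ l ∈ range k, (-(p * p ^ l)⁻¹) := by
      rw [prod_neg, prod_inv_distrib, prod_mul_distrib, prod_pow_id, prod_const, card_range,
        choose_two_succ, pow_add, mul_comm (p ^ k)]
    rw [e, qPoch, ← prod_mul_distrib, ← prod_range_reflect]
    refine prod_congr rfl fun l hl => ?_
    rw [mem_range] at hl
    obtain ⟨m, rfl⟩ := Nat.exists_eq_add_of_lt hl
    rw [show l + m + 1 - 1 - l = m by omega, show l + m + 1 = l + 1 + m by ring, pow_add, pow_succ]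
    field_simp
    ring
  have e2 : ∀ j, 1 - p ^ (k + 1 + j) / p ^ k = 1 - p * p ^ j := by
    intro j
    rw [pow_add, pow_succ]
    field_simp
  have e3 : qPoch p p (k + 1 + m + k) = qPoch p p k * (∏ l ∈ range k, (1 - p ^ (l + k + 1))) *
      (1 - p ^ (2 * k + 1)) * ∏ j ∈ range m, (1 - p ^ (k + 1 + j + k + 1)) := by
    rw [show k + 1 + m + k = k + k + 1 + m by ring, qPoch_add, qPoch_succ, qPoch_add]
    congr 1
    · congr 1
      · congr 1
        refine prod_congr rfl fun l _ => ?_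
        ring
      · ring
    · refine prod_congr rfl fun l _ => ?_
      ring
  have h : 1 - p ^ (2 * k + 1) ≠ 0 := sub_ne_zero.2 (hp1 _ (by omega)).symm
  simp_rw [e1, e2]
  rw [e3]
  simp only [qPoch]
  field_simp

/-- The quadratic factor `1 - u a + a²`. -/
def quadFactor {S : Type*} [CommRing S] (u a : S) : S := 1 - u * a + a ^ 2

theorem map_quadFactor {S S' : Type*} [CommRing S] [CommRing S'] (φ : S →+* S') (u a : S) :
    φ (quadFactor u a) = quadFactor (φ u) (φ a) := by
  simp [quadFactor]

section FieldIdentities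

variable {q : K}

theorem pow_ne_neg_one (h1 : ∀ n, 0 < n → q ^ n ≠ 1) {n : ℕ} (hn : 0 < n) : 1 + q ^ n ≠ 0 := by
  intro h
  refine h1 (n * 2) (by omega) ?_
  rw [pow_mul, eq_neg_of_add_eq_zero_right h]
  ring

theorem pow_ne_pow (h0 : q ≠ 0) (h1 : ∀ n, 0 < n → q ^ n ≠ 1) {m n : ℕ} (hmn : m ≠ n) :
    1 - q ^ m / q ^ n ≠ 0 := by
  rw [sub_ne_zero, ne_comm, Ne, div_eq_one_iff_eq (pow_ne_zero _ h0)]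
  intro h
  rcases lt_or_gt_of_ne hmn with hl | hl <;> obtain ⟨d, rfl⟩ := Nat.exists_eq_add_of_lt hl
  · refine h1 (d + 1) d.succ_pos (mul_left_cancel₀ (pow_ne_zero m h0) ?_)
    rw [← pow_add, mul_one, ← add_assoc, h]
  · refine h1 (d + 1) d.succ_pos (mul_left_cancel₀ (pow_ne_zero n h0) ?_)
    rw [← pow_add, mul_one, ← add_assoc, h]

theorem one_add_pow_div_pow_ne_zero (h0 : q ≠ 0) (h1 : ∀ n, 0 < n → q ^ n ≠ 1) {m n : ℕ}
    (hmn : m ≠ n) : 1 + q ^ m / q ^ n ≠ 0 := by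
  intro h
  refine pow_ne_pow (m := m * 2) (n := n * 2) h0 h1 (by omega) ?_
  rw [pow_mul, pow_mul, ← div_pow, eq_neg_of_add_eq_zero_right h]
  ring

theorem prod_quadFactor_inv_eq_sum (h0 : q ≠ 0) (h1 : ∀ n, 0 < n → q ^ n ≠ 1) (u : K)
    (hd : ∀ l : ℕ, quadFactor u (q ^ (2 * l + 1)) ≠ 0) {M : ℕ} (hM : 0 < M) :
    ∏ l ∈ range M, (quadFactor u (q ^ (2 * l + 1)))⁻¹ =
      ∑ k ∈ range M, (-1) ^ k * (q ^ 2) ^ (k + 1).choose 2 * (1 - q ^ (4 * k + 2)) *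
        (qPoch (q ^ 2) (q ^ 2) (M + k) * qPoch (q ^ 2) (q ^ 2) (M - 1 - k))⁻¹ *
        (quadFactor u (q ^ (2 * k + 1)))⁻¹ := by
  unfold quadFactor at *
  rw [prod_inv_eq_sum_partial_fractions (range M) ⟨0, by simpa using hM⟩
    (fun l => q ^ (2 * l + 1)) u (fun _ _ => pow_ne_zero _ h0)
    (fun i _ j _ hij => pow_ne_pow h0 h1 (by omega))
    (fun i _ j _ hij => by
      rw [← pow_add]
      exact sub_ne_zero.2 (h1 _ (by omega)).symm) (fun i _ => hd i)]
  refine sum_congr rfl fun k hk => ?_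
  have e : ∀ j, (1 - q ^ (2 * j + 1) * q ^ (2 * k + 1)) * (1 - q ^ (2 * j + 1) / q ^ (2 * k + 1)) =
      (1 - (q ^ 2) ^ (j + k + 1)) * (1 - (q ^ 2) ^ j / (q ^ 2) ^ k) := by
    intro j
    field_simp
    ring
  simp_rw [e]
  rw [prod_erase_eq (pow_ne_zero 2 h0) (fun n hn => by
    rw [← pow_mul]; exact h1 _ (by omega)) (by simpa using hk)]
  rw [mul_inv, mul_inv, mul_inv, inv_inv, inv_inv, ← inv_pow, inv_neg_one, ← pow_mul q 2 (2 * k + 1),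
    show 2 * (2 * k + 1) = 4 * k + 2 by ring]
  ring

/-- A product of two `q`-Pochhammer symbols modulo `q ^ 4`, balanced according to the parity
of `k`. -/
def parityPoch {S : Type*} [CommRing S] (q : S) (n k : ℕ) : S :=
  if Even k then
    qPoch (-q ^ 3) (q ^ 4) (n + (k + 1) / 2) * qPoch (-q) (q ^ 4) (n - (k + 1) / 2)
  else
    qPoch (-q) (q ^ 4) (n + (k + 1) / 2) * qPoch (-q ^ 3) (q ^ 4) (n - (k + 1) / 2)

theorem choose_two_even (r : ℕ) : (2 * r + 1).choose 2 = 3 * r + 4 * r.choose 2 := by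
  induction r with
  | zero => rfl
  | succ r ih =>
    rw [show 2 * (r + 1) + 1 = 2 * r + 1 + 1 + 1 by ring, choose_two_succ, choose_two_succ, ih,
      choose_two_succ]
    ring

theorem choose_two_odd (r : ℕ) : (2 * r + 2).choose 2 = (r + 1) + 4 * (r + 1).choose 2 := by
  rw [choose_two_succ, choose_two_even, choose_two_succ]
  ring

/-- A theta product in base `q⁴` shifted by `(k+1)/2` steps. The exponents `4l + 2 + 2k + 1` are 3
modulo 4 for even `k` and 1 modulo 4 for odd `k`, which exchanges the roles of `q` and `q³`. -/
theorem prod_mixed_odd (h0 : q ≠ 0) {n k : ℕ} (hk : (k + 1) / 2 ≤ n) :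
    ∏ l ∈ range n, ((1 + q ^ (4 * l + 2) * q ^ (2 * k + 1)) *
      (1 + q ^ (4 * l + 2) / q ^ (2 * k + 1))) =
      (q ^ (k + 1).choose 2)⁻¹ * parityPoch q n k := by
  rcases Nat.even_or_odd' k with ⟨r, rfl | rfl⟩
  · have hr : (2 * r + 1) / 2 = r := by omega
    rw [hr] at hk
    have := prod_shift_mul_prod_shift (c := q ^ 3) (d := q) (p := q ^ 4) (pow_ne_zero _ h0)
      (pow_ne_zero _ h0) (by ring) hk
    rw [parityPoch, if_pos (even_two_mul r), hr, choose_two_even,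
      show q ^ (3 * r + 4 * r.choose 2) = (q ^ 3) ^ r * (q ^ 4) ^ r.choose 2 by ring, ← this]
    refine prod_congr rfl fun l _ => ?_
    field_simp
    ring
  · have hr : (2 * r + 1 + 1) / 2 = r + 1 := by omega
    rw [hr] at hk
    have := prod_shift_mul_prod_shift (c := q) (d := q ^ 3) (p := q ^ 4) (pow_ne_zero _ h0)
      h0 (by ring) hk
    rw [parityPoch, if_neg (by simp), hr, choose_two_odd,
      show q ^ (r + 1 + 4 * (r + 1).choose 2) = q ^ (r + 1) * (q ^ 4) ^ (r + 1).choose 2 by ring,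
      ← this]
    refine prod_congr rfl fun l _ => ?_
    field_simp
    ring

/-- A theta product in base `q²` shifted by `r = 2k + 1` steps; the exponent extracted is `r² = 8
(k+1).choose 2 + 1`. -/
theorem prod_mixed_even (h0 : q ≠ 0) {N k : ℕ} (hk : 2 * k + 1 ≤ N) :
    ∏ l ∈ range N, ((1 + q ^ (2 * l + 1) * q ^ (4 * k + 2)) *
      (1 + q ^ (2 * l + 1) / q ^ (4 * k + 2))) =
      (q ^ (8 * (k + 1).choose 2 + 1))⁻¹ *
        (qPoch (-q) (q ^ 2) (N + (2 * k + 1)) * qPoch (-q) (q ^ 2) (N - (2 * k + 1))) := by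
  have := prod_shift_mul_prod_shift (c := q) (d := q) (p := q ^ 2) (pow_ne_zero _ h0)
      h0 (by ring) hk
  have e : 8 * (k + 1).choose 2 + 1 = (2 * k + 1) + 2 * (2 * k + 1).choose 2 := by
    rw [choose_two_succ, choose_two_even]
    have : k.choose 2 * 2 + k = k * k := by
      rw [Nat.choose_two_right, Nat.div_mul_cancel (Nat.even_mul_pred_self k).two_dvd]
      cases k
      · rfl
      · simp; ring
    omega
  rw [e, show q ^ (2 * k + 1 + 2 * (2 * k + 1).choose 2) =
    q ^ (2 * k + 1) * (q ^ 2) ^ (2 * k + 1).choose 2 by ring, ← this]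
  refine prod_congr rfl fun l _ => ?_
  field_simp
  ring

/-- Partial fractions for two families of nodes together. Taking `2n` nodes of the first kind
against `n` of the second keeps both shifts, `(k+1)/2 ≤ n` and `2k + 1 ≤ 2n`, within range. -/
theorem prod_quadFactor_inv_mul_eq_sum (h0 : q ≠ 0) (h1 : ∀ n, 0 < n → q ^ n ≠ 1) (u : K)
    (hd : ∀ l : ℕ, quadFactor u (q ^ (2 * l + 1)) ≠ 0)
    (hd' : ∀ l : ℕ, quadFactor (-u) (q ^ (4 * l + 2)) ≠ 0) {n : ℕ} (hn : 0 < n) :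
    (∏ l ∈ range (2 * n), (quadFactor u (q ^ (2 * l + 1)))⁻¹) *
      ∏ l ∈ range n, (quadFactor (-u) (q ^ (4 * l + 2)))⁻¹ =
    (∑ k ∈ range (2 * n), (-1) ^ k * q ^ (3 * (k + 1).choose 2) * (1 - q ^ (4 * k + 2)) *
        (qPoch (q ^ 2) (q ^ 2) (2 * n + k) * qPoch (q ^ 2) (q ^ 2) (2 * n - 1 - k) *
          parityPoch q n k)⁻¹ * (quadFactor u (q ^ (2 * k + 1)))⁻¹) +
    ∑ k ∈ range n, (-1) ^ k * q ^ (12 * (k + 1).choose 2 + 1) * (1 - q ^ (8 * k + 4)) *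
        (qPoch (q ^ 4) (q ^ 4) (n + k) * qPoch (q ^ 4) (q ^ 4) (n - 1 - k) *
          (qPoch (-q) (q ^ 2) (2 * n + (2 * k + 1)) *
            qPoch (-q) (q ^ 2) (2 * n - (2 * k + 1))))⁻¹ *
        (quadFactor (-u) (q ^ (4 * k + 2)))⁻¹ := by
  -- Changing the sign of the node changes the sign of `u`, so both families become factors of the
  -- form `1 - u a + a²`.
  set a : ℕ ⊕ ℕ → K := Sum.elim (fun l => q ^ (2 * l + 1)) (fun l => -q ^ (4 * l + 2)) with ha
  have hq : ∀ l, 1 - u * (-q ^ (4 * l + 2)) + (-q ^ (4 * l + 2)) ^ 2 =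
      quadFactor (-u) (q ^ (4 * l + 2)) := fun l => by rw [quadFactor]; ring
  have hq' : ∀ l, 1 - u * q ^ (2 * l + 1) + (q ^ (2 * l + 1)) ^ 2 =
      quadFactor u (q ^ (2 * l + 1)) := fun l => rfl
  have key := prod_inv_eq_sum_partial_fractions ((range (2 * n)).disjSum (range n))
    ⟨Sum.inr 0, by simpa using hn⟩ a u
    (by rintro (i | i) _ <;> simp [ha, h0])
    (by
      rintro (i | i) _ (j | j) _ hij <;> simp only [ha, Sum.elim_inl, Sum.elim_inr]
      · exact pow_ne_pow h0 h1 (by simp at hij; omega)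
      · rw [neg_div, sub_neg_eq_add]
        exact one_add_pow_div_pow_ne_zero h0 h1 (by omega)
      · rw [div_neg, sub_neg_eq_add]
        exact one_add_pow_div_pow_ne_zero h0 h1 (by omega)
      · rw [neg_div_neg_eq]
        exact pow_ne_pow h0 h1 (by simp at hij; omega))
    (by
      rintro (i | i) _ (j | j) _ hij <;> simp only [ha, Sum.elim_inl, Sum.elim_inr]
      · rw [← pow_add]
        exact sub_ne_zero.2 (h1 _ (by omega)).symm
      · rw [neg_mul, ← pow_add, sub_neg_eq_add]
        exact pow_ne_neg_one h1 (by omega)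
      · rw [mul_neg, ← pow_add, sub_neg_eq_add]
        exact pow_ne_neg_one h1 (by omega)
      · rw [neg_mul_neg, ← pow_add]
        exact sub_ne_zero.2 (h1 _ (by omega)).symm)
    (by
      rintro (i | i) _ <;> simp only [ha, Sum.elim_inl, Sum.elim_inr]
      · exact hd i
      · rw [hq]
        exact hd' i)
  rw [prod_disjSum, sum_disjSum] at key
  simp only [ha, Sum.elim_inl, Sum.elim_inr, hq, hq'] at key
  refine key.trans ?_
  congr 1
  · refine sum_congr rfl fun k hk => ?_
    rw [mem_range] at hk
    have e : ((range (2 * n)).disjSum (range n)).erase (Sum.inl k) =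
        ((range (2 * n)).erase k).disjSum (range n) := by
      ext (x | x) <;> simp
    rw [e, prod_disjSum]
    simp only [Sum.elim_inl, Sum.elim_inr, neg_mul, neg_div, sub_neg_eq_add]
    have e : ∀ j, (1 - q ^ (2 * j + 1) * q ^ (2 * k + 1)) *
        (1 - q ^ (2 * j + 1) / q ^ (2 * k + 1)) =
        (1 - (q ^ 2) ^ (j + k + 1)) * (1 - (q ^ 2) ^ j / (q ^ 2) ^ k) := by
      intro j
      field_simp
      ring
    simp_rw [e]
    rw [prod_erase_eq (pow_ne_zero 2 h0) (fun n hn => by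
      rw [← pow_mul]; exact h1 _ (by omega)) hk, prod_mixed_odd h0 (by omega)]
    simp only [mul_inv, inv_inv]
    rw [← inv_pow, inv_neg_one, ← pow_mul q 2 (2 * k + 1), show 2 * (2 * k + 1) = 4 * k + 2 by ring]
    ring
  · refine sum_congr rfl fun k hk => ?_
    rw [mem_range] at hk
    have e : ((range (2 * n)).disjSum (range n)).erase (Sum.inr k) =
        (range (2 * n)).disjSum ((range n).erase k) := by
      ext (x | x) <;> simp
    rw [e, prod_disjSum]
    simp only [Sum.elim_inl, Sum.elim_inr, mul_neg, neg_mul, neg_div, div_neg, neg_neg,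
      sub_neg_eq_add]
    have e : ∀ j, (1 - q ^ (4 * j + 2) * q ^ (4 * k + 2)) *
        (1 - q ^ (4 * j + 2) / q ^ (4 * k + 2)) =
        (1 - (q ^ 4) ^ (j + k + 1)) * (1 - (q ^ 4) ^ j / (q ^ 4) ^ k) := by
      intro j
      field_simp
      ring
    simp_rw [e]
    rw [prod_erase_eq (pow_ne_zero 4 h0) (fun n hn => by
      rw [← pow_mul]; exact h1 _ (by omega)) hk, prod_mixed_even h0 (by omega)]
    simp only [mul_inv, inv_inv]
    rw [← inv_pow, inv_neg_one, ← pow_mul q 4 (2 * k + 1), show 4 * (2 * k + 1) = 8 * k + 4 by ring]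
    ring

end FieldIdentities

/-! ### Transfer of the finite identities to power series. -/

theorem algebraMap_fractionRing_inv {f : k⟦X⟧} (hf : constantCoeff f ≠ 0) :
    algebraMap k⟦X⟧ (FractionRing k⟦X⟧) f⁻¹ = (algebraMap k⟦X⟧ (FractionRing k⟦X⟧) f)⁻¹ := by
  refine eq_inv_of_mul_eq_one_left ?_
  rw [← map_mul, PowerSeries.inv_mul_cancel _ hf, map_one]

theorem constantCoeff_quadFactor (u : k) {n : ℕ} (hn : n ≠ 0) :
    constantCoeff (quadFactor (C u) (X ^ n : k⟦X⟧)) = 1 := by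
  simp [quadFactor, hn]

theorem constantCoeff_qPoch_X (a b n : ℕ) (ha : a ≠ 0) :
    constantCoeff (qPoch (X ^ a : k⟦X⟧) (X ^ b) n) = 1 :=
  constantCoeff_qPoch (by simp [ha]) _ _

theorem constantCoeff_parityPoch (n j : ℕ) :
    constantCoeff (parityPoch (X : k⟦X⟧) n j) = 1 := by
  have h1 : ∀ m, constantCoeff (qPoch (-X : k⟦X⟧) (X ^ 4) m) = 1 := fun m =>
    constantCoeff_qPoch (by simp) _ _
  have h3 : ∀ m, constantCoeff (qPoch (-X ^ 3 : k⟦X⟧) (X ^ 4) m) = 1 := fun m =>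
    constantCoeff_qPoch (by simp) _ _
  unfold parityPoch
  split <;> simp [h1, h3]

theorem map_parityPoch {S S' : Type*} [CommRing S] [CommRing S'] (φ : S →+* S') (q : S)
    (n j : ℕ) : φ (parityPoch q n j) = parityPoch (φ q) n j := by
  unfold parityPoch
  split <;> simp [map_qPoch]

theorem algebraMap_X_pow_ne_one {n : ℕ} (hn : 0 < n) :
    (algebraMap k⟦X⟧ (FractionRing k⟦X⟧) X) ^ n ≠ 1 := by
  rw [← map_pow, ← map_one (algebraMap k⟦X⟧ (FractionRing k⟦X⟧)),
    (IsFractionRing.injective k⟦X⟧ (FractionRing k⟦X⟧)).ne_iff]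
  intro h
  have := congrArg constantCoeff h
  simp [hn.ne'] at this

theorem algebraMap_X_ne_zero : algebraMap k⟦X⟧ (FractionRing k⟦X⟧) X ≠ 0 := by
  rw [← map_zero (algebraMap k⟦X⟧ (FractionRing k⟦X⟧)),
    (IsFractionRing.injective k⟦X⟧ (FractionRing k⟦X⟧)).ne_iff]
  exact X_ne_zero

theorem algebraMap_ne_zero_of_constantCoeff {f : k⟦X⟧} (hf : constantCoeff f ≠ 0) :
    algebraMap k⟦X⟧ (FractionRing k⟦X⟧) f ≠ 0 := by
  rw [← map_zero (algebraMap k⟦X⟧ (FractionRing k⟦X⟧)),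
    (IsFractionRing.injective k⟦X⟧ (FractionRing k⟦X⟧)).ne_iff]
  rintro rfl
  simp at hf

section Transfer

variable (u : k)

theorem algebraMap_quadFactor_inv {n : ℕ} (hn : n ≠ 0) :
    algebraMap k⟦X⟧ (FractionRing k⟦X⟧) (quadFactor (C u) (X ^ n))⁻¹ =
      (quadFactor (algebraMap k⟦X⟧ (FractionRing k⟦X⟧) (C u))
        ((algebraMap k⟦X⟧ (FractionRing k⟦X⟧) X) ^ n))⁻¹ := by
  rw [algebraMap_fractionRing_inv (by simp [constantCoeff_quadFactor u hn]), map_quadFactor,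
    map_pow]

theorem quadFactor_algebraMap_ne_zero {n : ℕ} (hn : n ≠ 0) :
    quadFactor (algebraMap k⟦X⟧ (FractionRing k⟦X⟧) (C u))
        ((algebraMap k⟦X⟧ (FractionRing k⟦X⟧) X) ^ n) ≠ 0 := by
  rw [← map_pow, ← map_quadFactor]
  exact algebraMap_ne_zero_of_constantCoeff (by simp [constantCoeff_quadFactor u hn])

/-- The field identity needs `q` to be invertible, so it is applied in the fraction field. It
descends because every series inverted in the result has constant term 1. -/
theorem prod_inv_eq_sum_powerSeries {M : ℕ} (hM : 0 < M) :
    ∏ l ∈ range M, (quadFactor (C u) (X ^ (2 * l + 1) : k⟦X⟧))⁻¹ =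
      ∑ j ∈ range M, (-1) ^ j * (X ^ 2) ^ (j + 1).choose 2 * (1 - X ^ (4 * j + 2)) *
        (qPoch (X ^ 2) (X ^ 2) (M + j) * qPoch (X ^ 2) (X ^ 2) (M - 1 - j))⁻¹ *
        (quadFactor (C u) (X ^ (2 * j + 1)))⁻¹ := by
  apply IsFractionRing.injective k⟦X⟧ (FractionRing k⟦X⟧)
  have key := prod_quadFactor_inv_eq_sum (algebraMap_X_ne_zero (k := k))
    (fun n hn => algebraMap_X_pow_ne_one hn) (algebraMap k⟦X⟧ (FractionRing k⟦X⟧) (C u))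
    (fun l => quadFactor_algebraMap_ne_zero u (by omega)) hM
  have e : ∀ a b, algebraMap k⟦X⟧ (FractionRing k⟦X⟧)
      (qPoch (X ^ 2) (X ^ 2) a * qPoch (X ^ 2) (X ^ 2) b)⁻¹ =
      (algebraMap k⟦X⟧ (FractionRing k⟦X⟧)
        (qPoch (X ^ 2) (X ^ 2) a * qPoch (X ^ 2) (X ^ 2) b))⁻¹ := fun a b =>
    algebraMap_fractionRing_inv (by simp [constantCoeff_qPoch_X])
  have e' := fun l => algebraMap_quadFactor_inv u (n := 2 * l + 1) (by omega)
  simp only [map_sum, map_prod, map_mul, e, e', map_pow, map_neg, map_one, map_sub, map_qPoch]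
  exact key

theorem prod_inv_mul_eq_sum_powerSeries {n : ℕ} (hn : 0 < n) :
    (∏ l ∈ range (2 * n), (quadFactor (C u) (X ^ (2 * l + 1) : k⟦X⟧))⁻¹) *
      ∏ l ∈ range n, (quadFactor (C (-u)) (X ^ (4 * l + 2) : k⟦X⟧))⁻¹ =
    (∑ j ∈ range (2 * n), (-1) ^ j * X ^ (3 * (j + 1).choose 2) * (1 - X ^ (4 * j + 2)) *
        (qPoch (X ^ 2) (X ^ 2) (2 * n + j) * qPoch (X ^ 2) (X ^ 2) (2 * n - 1 - j) *
          parityPoch X n j)⁻¹ * (quadFactor (C u) (X ^ (2 * j + 1)))⁻¹) +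
    ∑ j ∈ range n, (-1) ^ j * X ^ (12 * (j + 1).choose 2 + 1) * (1 - X ^ (8 * j + 4)) *
        (qPoch (X ^ 4) (X ^ 4) (n + j) * qPoch (X ^ 4) (X ^ 4) (n - 1 - j) *
          (qPoch (-X) (X ^ 2) (2 * n + (2 * j + 1)) *
            qPoch (-X) (X ^ 2) (2 * n - (2 * j + 1))))⁻¹ *
        (quadFactor (C (-u)) (X ^ (4 * j + 2)))⁻¹ := by
  apply IsFractionRing.injective k⟦X⟧ (FractionRing k⟦X⟧)
  have key := prod_quadFactor_inv_mul_eq_sum (algebraMap_X_ne_zero (k := k))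
    (fun n hn => algebraMap_X_pow_ne_one hn) (algebraMap k⟦X⟧ (FractionRing k⟦X⟧) (C u))
    (fun l => quadFactor_algebraMap_ne_zero u (by omega))
    (fun l => by
      rw [← map_neg, ← map_neg]
      exact quadFactor_algebraMap_ne_zero (-u) (by omega)) hn
  have c1 : ∀ m, constantCoeff (qPoch (-X : k⟦X⟧) (X ^ 2) m) = 1 := fun m =>
    constantCoeff_qPoch (by simp) _ _
  have e1 : ∀ a b i j, algebraMap k⟦X⟧ (FractionRing k⟦X⟧)
      (qPoch (X ^ 2) (X ^ 2) a * qPoch (X ^ 2) (X ^ 2) b * parityPoch X i j)⁻¹ =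
      (algebraMap k⟦X⟧ (FractionRing k⟦X⟧)
        (qPoch (X ^ 2) (X ^ 2) a * qPoch (X ^ 2) (X ^ 2) b * parityPoch X i j))⁻¹ :=
    fun a b i j => algebraMap_fractionRing_inv
      (by simp [constantCoeff_qPoch_X, constantCoeff_parityPoch])
  have e2 : ∀ a b i j, algebraMap k⟦X⟧ (FractionRing k⟦X⟧)
      (qPoch (X ^ 4) (X ^ 4) a * qPoch (X ^ 4) (X ^ 4) b *
        (qPoch (-X) (X ^ 2) i * qPoch (-X) (X ^ 2) j))⁻¹ =
      (algebraMap k⟦X⟧ (FractionRing k⟦X⟧)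
        (qPoch (X ^ 4) (X ^ 4) a * qPoch (X ^ 4) (X ^ 4) b *
          (qPoch (-X) (X ^ 2) i * qPoch (-X) (X ^ 2) j)))⁻¹ :=
    fun a b i j => algebraMap_fractionRing_inv
      (by simp [constantCoeff_qPoch_X, c1])
  have e3 := fun l => algebraMap_quadFactor_inv u (n := 2 * l + 1) (by omega)
  have e4 := fun l => algebraMap_quadFactor_inv (-u) (n := 4 * l + 2) (by omega)
  simp only [map_neg] at e4
  simp only [map_add, map_sum, map_prod, map_mul, e1, e2, e3, e4, map_pow, map_neg, map_one,
    map_sub, map_qPoch, map_parityPoch]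
  exact key

end Transfer

/-! ### Cauchy's identity and the Watson–Whipple limit. -/

theorem two_mul_choose_two (n : ℕ) : 2 * (n + 1).choose 2 = n * (n + 1) := by
  induction n with
  | zero => rfl
  | succ n ih => rw [choose_two_succ, mul_add, ih]; ring

theorem le_choose_two (n : ℕ) : n ≤ (n + 1).choose 2 := by
  rw [choose_two_succ]
  omega

theorem qPoch_inv_eq {c : k⟦X⟧} (hc : constantCoeff c = 0) (p : k⟦X⟧) (n : ℕ) :
    (qPoch c p n)⁻¹ = (1 - c * p ^ n) * (qPoch c p (n + 1))⁻¹ := by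
  have h1 := PowerSeries.mul_inv_cancel (qPoch c p n) (by simp [constantCoeff_qPoch hc])
  have h2 := PowerSeries.mul_inv_cancel (qPoch c p (n + 1)) (by simp [constantCoeff_qPoch hc])
  rw [qPoch_succ] at h2 ⊢
  linear_combination (-(qPoch c p n)⁻¹) * h2 +
    ((1 - c * p ^ n) * (qPoch c p n * (1 - c * p ^ n))⁻¹) * h1

/-- Cauchy's identity for the Durfee rectangle dissection. -/
theorem cauchy_durfee {q : k⟦X⟧} (hq : X ∣ q) (r : ℕ) :
    XAdicLim (fun M => ∑ m ∈ range M, q ^ (m * (m + r)) * (qPoch q q m * qPoch q q (m + r))⁻¹)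
      (qPochInf q q)⁻¹ := by
  have hq0 : constantCoeff q = 0 := X_dvd_iff.1 hq
  have hc : ∀ n, constantCoeff (qPoch q q n) ≠ 0 := fun n => by simp [constantCoeff_qPoch hq0]
  set t : ℕ → ℕ → k⟦X⟧ := fun r m => q ^ (m * (m + r)) * (qPoch q q m * qPoch q q (m + r))⁻¹
    with ht
  have hpow : ∀ a b, a ≤ b → (X : k⟦X⟧) ^ a ∣ q ^ b := fun a b hab =>
    (pow_dvd_pow_of_dvd hq a).trans (pow_dvd_pow q hab)
  have htd : ∀ r m, (X : k⟦X⟧) ^ m ∣ t r m := fun r m =>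
    (hpow m _ (by nlinarith [Nat.le_mul_self m])).mul_right _
  have htr : ∀ r m, m ≠ 0 → (X : k⟦X⟧) ^ r ∣ t r m := fun r m hm =>
    (hpow r _ (by nlinarith [Nat.pos_of_ne_zero hm])).mul_right _
  have hlim : ∀ r, XAdicLim (fun M => ∑ m ∈ range M, t r m) (infSum (t r)) := fun r =>
    infSum_lim (htd r)
  have hsucc := qPoch_inv_eq hq0 q
  -- The sum does not depend on `r`: the partial sums for `r` and `r + 1` differ by a boundary term
  -- that tends to 0. Letting `r` grow then leaves only the `m = 0` term.
  have hstep : ∀ r, infSum (t r) = infSum (t (r + 1)) := by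
    intro r
    have tele : ∀ M, ∑ m ∈ range M, t r m = ∑ m ∈ range M, t (r + 1) m +
        (-((1 - q ^ M) * t r M)) := by
      intro M
      induction M with
      | zero => simp
      | succ M ih =>
        rw [sum_range_succ, sum_range_succ, ih]
        simp only [ht, PowerSeries.mul_inv_rev]
        rw [show M + 1 + r = M + r + 1 by ring, show M + (r + 1) = M + r + 1 by ring,
          hsucc M, hsucc (M + r)]
        ring
    refine (hlim r).unique ?_
    simp_rw [tele]
    rw [← add_zero (infSum (t (r + 1)))]
    refine (hlim (r + 1)).add (XAdicLim.zero_of_dvd fun n => ?_)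
    exact (((htd r n).mul_left _)).neg_right
  have hconst : ∀ n, infSum (t r) = infSum (t (r + n)) := by
    intro n
    induction n with
    | zero => rfl
    | succ n ih => rw [ih, hstep]; rfl
  have happrox : ∀ n, (X : k⟦X⟧) ^ n ∣ infSum (t (r + n)) - (qPoch q q (r + n))⁻¹ := by
    intro n
    rw [X_pow_dvd_iff]
    intro d hd
    rw [map_sub, sub_eq_zero, infSum, coeff_mk, sum_eq_single 0]
    · simp [ht, qPoch_zero]
    · intro m _ hm
      exact X_pow_dvd_iff.1 (htr (r + n) m hm) d (by omega)
    · simp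
  have hfin : infSum (t r) = (qPochInf q q)⁻¹ := by
    refine (XAdicLim.const (infSum (t r))).unique ?_
    have h1 := (((qPoch_lim q hq).inv hc (by simp [constantCoeff_qPochInf hq0])).comp
      (tendsto_add_atTop_nat r)).add (XAdicLim.zero_of_dvd happrox)
    rw [add_zero] at h1
    refine h1.congr' (.of_forall fun n => ?_)
    rw [hconst n, add_comm n r]
    ring
  rw [← hfin]
  exact hlim r

/-- The term `(-1)ʲ q^{e j(j+1)/2} (1 - q^{4j+2}) / (1 - u q^{2j+1} + q^{4j+2})`. -/
noncomputable def lambertTerm (e : ℕ) (u : k) (j : ℕ) : k⟦X⟧ :=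
  (-1) ^ j * X ^ (e * (j + 1).choose 2) * (1 - X ^ (4 * j + 2)) *
    (quadFactor (C u) (X ^ (2 * j + 1)))⁻¹

theorem lambertTerm_dvd {e : ℕ} (he : 0 < e) (u : k) (j : ℕ) :
    (X : k⟦X⟧) ^ j ∣ lambertTerm e u j := by
  unfold lambertTerm
  refine Dvd.dvd.mul_right (Dvd.dvd.mul_right (Dvd.dvd.mul_left (pow_dvd_pow _ ?_) _) _) _
  exact (le_choose_two j).trans (Nat.le_mul_of_pos_left _ he)

/-- The Appell–Lerch type sum with terms `lambertTerm e u`. -/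
noncomputable def lambertSum (e : ℕ) (u : k) : k⟦X⟧ := infSum (lambertTerm e u)

/-- A limiting case of the Watson–Whipple transformation. -/
theorem watson_whipple (u : k) :
    XAdicLim (fun M => ∑ D ∈ range M, X ^ (4 * (D + 1).choose 2) *
      ∏ l ∈ range (D + 1), (quadFactor (C u) (X ^ (2 * l + 1) : k⟦X⟧))⁻¹)
      ((qPochInf (X ^ 2) (X ^ 2))⁻¹ * lambertSum 6 u) := by
  have hX2 : (X : k⟦X⟧) ∣ X ^ 2 := dvd_pow_self _ two_ne_zero
  have key : ∀ M, ∑ D ∈ range M, X ^ (4 * (D + 1).choose 2) *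
      ∏ l ∈ range (D + 1), (quadFactor (C u) (X ^ (2 * l + 1) : k⟦X⟧))⁻¹ =
      ∑ j ∈ range M, lambertTerm 6 u j * ∑ m ∈ range (M - j),
        (X ^ 2) ^ (m * (m + (2 * j + 1))) *
          (qPoch (X ^ 2) (X ^ 2) m * qPoch (X ^ 2) (X ^ 2) (m + (2 * j + 1)))⁻¹ := by
    intro M
    simp_rw [prod_inv_eq_sum_powerSeries u (Nat.succ_pos _), mul_sum]
    rw [sum_comm' (t' := range M) (s' := fun j => Ico j M)
      (by intro x y; simp only [mem_range, mem_Ico]; omega)]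
    refine sum_congr rfl fun j _ => ?_
    rw [sum_Ico_eq_sum_range]
    refine sum_congr rfl fun m _ => ?_
    -- With `D = j + m` the exponent separates: the inner sum over `m` is Cauchy's with `r = 2j + 1`
    -- and base `q²`, while `4 (j+1).choose 2` joins `2 (j+1).choose 2` from the partial fractions
    -- to give the 6 in `lambertTerm 6`.
    have e1 : 4 * (j + m + 1).choose 2 = 4 * (j + 1).choose 2 + 2 * (m * (m + (2 * j + 1))) := by
      have h1 := two_mul_choose_two (j + m)
      have h2 := two_mul_choose_two j
      nlinarith
    rw [e1, show j + m + 1 + j = m + (2 * j + 1) by ring, show j + m + 1 - 1 - j = m by omega,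
      mul_comm (qPoch (X ^ 2 : k⟦X⟧) (X ^ 2) (m + (2 * j + 1)))]
    unfold lambertTerm
    ring
  simp_rw [key]
  unfold lambertSum
  rw [← infSum_mul_left (lambertTerm_dvd (by norm_num) u)]
  refine XAdicLim.sum_of_dominated tendsto_id
    (fun n j _ => (lambertTerm_dvd (by norm_num) u j).mul_right _) fun j => ?_
  rw [mul_comm _ (lambertTerm 6 u j)]
  exact ((cauchy_durfee hX2 (2 * j + 1)).comp (tendsto_sub_atTop_nat j)).const_mul _

/-! ### Partial fractions of the infinite theta quotient. -/

theorem expand_inv (m : ℕ) (hm : m ≠ 0) {f : k⟦X⟧} (hf : constantCoeff f ≠ 0) :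
    expand m hm f⁻¹ = (expand m hm f)⁻¹ := by
  have h : constantCoeff (expand m hm f) ≠ 0 := by rwa [constantCoeff_expand]
  rw [PowerSeries.eq_inv_iff_mul_eq_one h, ← map_mul, PowerSeries.inv_mul_cancel _ hf, map_one]

theorem expand_quadFactor (m : ℕ) (hm : m ≠ 0) (u : k) (n : ℕ) :
    expand m hm (quadFactor (C u) (X ^ n)) = quadFactor (C u) (X ^ (m * n)) := by
  simp only [quadFactor, map_add, map_sub, map_mul, map_one, map_pow, expand_X, expand_C, pow_mul]

theorem quadFactor_dvd (u : k) (l : ℕ) :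
    (X : k⟦X⟧) ^ l ∣ quadFactor (C u) (X ^ (2 * l + 1)) - 1 := by
  rw [quadFactor, show (1 : k⟦X⟧) - C u * X ^ (2 * l + 1) + (X ^ (2 * l + 1)) ^ 2 - 1 =
    X ^ l * (X ^ (3 * l + 2) - C u * X ^ (l + 1)) by ring]
  exact dvd_mul_right _ _

/-- The product `∏ (1 - u q^{2l+1} + q^{4l+2})`. -/
noncomputable def thetaDenom (u : k) : k⟦X⟧ :=
  infProd fun l => quadFactor (C u) (X ^ (2 * l + 1))

theorem thetaDenom_lim (u : k) :
    XAdicLim (fun n => ∏ l ∈ range n, quadFactor (C u) (X ^ (2 * l + 1))) (thetaDenom u) :=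
  infProd_lim (quadFactor_dvd u)

theorem constantCoeff_thetaDenom (u : k) : constantCoeff (thetaDenom u) = 1 := by
  rw [thetaDenom, constantCoeff_infProd]
  exact constantCoeff_quadFactor u (by norm_num)

theorem expand_lambertTerm (m : ℕ) (hm : m ≠ 0) (e : ℕ) (u : k) (j : ℕ) :
    expand m hm (lambertTerm e u j) =
      (-1) ^ j * X ^ (m * (e * (j + 1).choose 2)) * (1 - X ^ (m * (4 * j + 2))) *
        (quadFactor (C u) (X ^ (m * (2 * j + 1))))⁻¹ := by
  rw [lambertTerm, map_mul, expand_inv m hm (by rw [constantCoeff_quadFactor u (by omega)]; simp),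
    expand_quadFactor]
  simp [pow_mul]

theorem prod_inv_powerSeries {ι : Type*} (s : Finset ι) (f : ι → k⟦X⟧) :
    ∏ i ∈ s, (f i)⁻¹ = (∏ i ∈ s, f i)⁻¹ := by
  classical
  induction s using Finset.induction_on with
  | empty => simp
  | insert a s ha ih => rw [prod_insert ha, prod_insert ha, ih, PowerSeries.mul_inv_rev, mul_comm]

theorem tendsto_of_add_le {φ : ℕ → ℕ} (c : ℕ) (h : ∀ n, n ≤ φ n + c) : Tendsto φ atTop atTop :=
  tendsto_atTop_atTop.2 fun b => ⟨b + c, fun a ha => by have := h a; omega⟩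

/-- The finite shift disappears in the limit, and for either parity the two residue classes 1 and 3
modulo 4 combine into all odd exponents. -/
theorem parityPoch_lim (j : ℕ) :
    XAdicLim (fun n => parityPoch (X : k⟦X⟧) n j) (qPochInf (-X) (X ^ 2)) := by
  have hX4 : (X : k⟦X⟧) ∣ X ^ 4 := dvd_pow_self _ (by norm_num)
  have hX2 : (X : k⟦X⟧) ∣ X ^ 2 := dvd_pow_self _ (by norm_num)
  have e : qPochInf (-X : k⟦X⟧) (X ^ 2) = qPochInf (-X) (X ^ 4) * qPochInf (-X ^ 3) (X ^ 4) := by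
    rw [qPochInf_dissect _ hX2]
    congr 2 <;> ring
  have t1 : Tendsto (fun n => n + (j + 1) / 2) atTop atTop :=
    tendsto_of_add_le 0 fun n => by omega
  have t2 : Tendsto (fun n => n - (j + 1) / 2) atTop atTop :=
    tendsto_of_add_le ((j + 1) / 2) fun n => by omega
  unfold parityPoch
  split
  · rw [e, mul_comm]
    exact ((qPoch_lim _ hX4).comp t1).mul ((qPoch_lim _ hX4).comp t2)
  · rw [e]
    exact ((qPoch_lim _ hX4).comp t1).mul ((qPoch_lim _ hX4).comp t2)

/-- Partial fraction expansion of the reciprocal of a product of theta functions. -/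
theorem theta_partial_fractions (u : k) :
    (thetaDenom u)⁻¹ * (expand 2 two_ne_zero (thetaDenom (-u)))⁻¹ =
      (qPochInf (X ^ 2) (X ^ 2) * qPochInf (X ^ 2) (X ^ 2) * qPochInf (-X) (X ^ 2))⁻¹ *
          lambertSum 3 u +
        X * (qPochInf (X ^ 4) (X ^ 4) * qPochInf (X ^ 4) (X ^ 4) *
          (qPochInf (-X) (X ^ 2) * qPochInf (-X) (X ^ 2)))⁻¹ *
          expand 2 two_ne_zero (lambertSum 6 (-u)) := by
  have hX4 : (X : k⟦X⟧) ∣ X ^ 4 := dvd_pow_self _ (by norm_num)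
  have hX2 : (X : k⟦X⟧) ∣ X ^ 2 := dvd_pow_self _ (by norm_num)
  have c1 : ∀ m, constantCoeff (qPoch (-X : k⟦X⟧) (X ^ 2) m) = 1 := fun m =>
    constantCoeff_qPoch (by simp) _ _
  have c2 : constantCoeff (qPochInf (-X : k⟦X⟧) (X ^ 2)) = 1 :=
    constantCoeff_qPochInf (by simp) _
  have c3 : constantCoeff (qPochInf (X ^ 2 : k⟦X⟧) (X ^ 2)) = 1 :=
    constantCoeff_qPochInf (by simp) _
  have c4 : constantCoeff (qPochInf (X ^ 4 : k⟦X⟧) (X ^ 4)) = 1 :=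
    constantCoeff_qPochInf (by simp) _
  have lhs := (((thetaDenom_lim u).comp (tendsto_of_add_le (φ := fun n => 2 * n) 0
      fun n => by omega)).inv
      (fun n => by
        rw [map_prod, prod_eq_one fun l _ => constantCoeff_quadFactor u (by omega)]
        exact one_ne_zero) (by simp [constantCoeff_thetaDenom])).mul
    (((thetaDenom_lim (-u)).expand 2 two_ne_zero).inv
      (fun n => by
        rw [constantCoeff_expand, map_prod,
          prod_eq_one fun l _ => constantCoeff_quadFactor (-u) (by omega)]
        exact one_ne_zero) (by simp [constantCoeff_thetaDenom]))
  refine lhs.unique ?_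
  have ht3 := lambertTerm_dvd (k := k) (e := 3) (by norm_num) u
  have ht6 : ∀ j, (X : k⟦X⟧) ^ j ∣ expand 2 two_ne_zero (lambertTerm 6 (-u) j) := by
    intro j
    rw [expand_lambertTerm]
    refine Dvd.dvd.mul_right (Dvd.dvd.mul_right (Dvd.dvd.mul_left (pow_dvd_pow _ ?_) _) _) _
    have := le_choose_two j
    omega
  have lim1 : XAdicLim (fun n => ∑ j ∈ range (2 * n),
      (qPoch (X ^ 2) (X ^ 2) (2 * n + j) * qPoch (X ^ 2) (X ^ 2) (2 * n - 1 - j) *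
          parityPoch X n j)⁻¹ * lambertTerm 3 u j)
      ((qPochInf (X ^ 2) (X ^ 2) * qPochInf (X ^ 2) (X ^ 2) * qPochInf (-X) (X ^ 2))⁻¹ *
          lambertSum 3 u) := by
    rw [lambertSum, ← infSum_mul_left ht3]
    refine XAdicLim.sum_of_dominated (tendsto_of_add_le 0 fun n => by omega)
      (fun n j _ => (ht3 j).mul_left _) fun j => XAdicLim.mul_const (XAdicLim.inv
        ((((qPoch_lim _ hX2).comp (tendsto_of_add_le 0 fun n => by omega)).mul
        ((qPoch_lim _ hX2).comp (tendsto_of_add_le (j + 1) fun n => by omega))).mul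
        (parityPoch_lim j)) (fun n => ?_) ?_) _
    · simp [constantCoeff_qPoch_X, constantCoeff_parityPoch]
    · simp [c2, c3]
  have lim2 : XAdicLim (fun n => ∑ j ∈ range n,
      (qPoch (X ^ 4) (X ^ 4) (n + j) * qPoch (X ^ 4) (X ^ 4) (n - 1 - j) *
          (qPoch (-X) (X ^ 2) (2 * n + (2 * j + 1)) *
            qPoch (-X) (X ^ 2) (2 * n - (2 * j + 1))))⁻¹ *
          expand 2 two_ne_zero (lambertTerm 6 (-u) j))
      ((qPochInf (X ^ 4) (X ^ 4) * qPochInf (X ^ 4) (X ^ 4) *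
          (qPochInf (-X) (X ^ 2) * qPochInf (-X) (X ^ 2)))⁻¹ *
          expand 2 two_ne_zero (lambertSum 6 (-u))) := by
    rw [lambertSum, expand_infSum (lambertTerm_dvd (by norm_num) (-u)), ← infSum_mul_left ht6]
    refine XAdicLim.sum_of_dominated tendsto_id
      (fun n j _ => (ht6 j).mul_left _) fun j => XAdicLim.mul_const (XAdicLim.inv
        ((((qPoch_lim _ hX4).comp (tendsto_of_add_le 0 fun n => by omega)).mul
        ((qPoch_lim _ hX4).comp (tendsto_of_add_le (j + 1) fun n => by omega))).mul
        (((qPoch_lim _ hX2).comp (tendsto_of_add_le 0 fun n => by omega)).mul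
        ((qPoch_lim _ hX2).comp (tendsto_of_add_le (2 * j + 1) fun n => by omega))))
          (fun n => ?_) ?_) _
    · simp [constantCoeff_qPoch_X, c1]
    · simp [c2, c4]
  rw [mul_assoc X]
  refine (lim1.add (lim2.const_mul X)).congr' ?_
  filter_upwards [eventually_gt_atTop 0] with n hn
  have key := prod_inv_mul_eq_sum_powerSeries u hn
  rw [prod_inv_powerSeries, prod_inv_powerSeries] at key
  rw [map_prod]
  simp only [expand_quadFactor, show ∀ l, 2 * (2 * l + 1) = 4 * l + 2 by intro l; ring]
  rw [key, mul_sum]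
  congr 1
  · refine sum_congr rfl fun j _ => ?_
    unfold lambertTerm
    ring
  · refine sum_congr rfl fun j _ => ?_
    rw [expand_lambertTerm, show 2 * (2 * j + 1) = 4 * j + 2 by ring,
      show 2 * (4 * j + 2) = 8 * j + 4 by ring,
      show 2 * (6 * (j + 1).choose 2) = 12 * (j + 1).choose 2 by ring]
    ring

theorem expand_two_qPochInf_X (a b : ℕ) (hb : b ≠ 0) :
    expand 2 two_ne_zero (qPochInf (X ^ a : k⟦X⟧) (X ^ b)) = qPochInf (X ^ (2 * a)) (X ^ (2 * b)) := by
  rw [expand_qPochInf _ (dvd_pow_self _ hb)]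
  simp [pow_mul]

/-! ### Gauss' product formula for the theta series. -/

section Gauss

/-- The terms of the finite form of Gauss' identity for `∑ q^{j²}`. -/
noncomputable def gaussTerm (n j : ℕ) : k⟦X⟧ :=
  if j ≤ n then X ^ (j ^ 2) * qPoch (X ^ 2) (X ^ 2) (2 * n) *
    ((qPoch (X ^ 2) (X ^ 2) (n + j))⁻¹ * (qPoch (X ^ 2) (X ^ 2) (n - j))⁻¹) else 0

theorem gaussTerm_of_lt {n j : ℕ} (h : n < j) : gaussTerm (k := k) n j = 0 :=
  if_neg (by omega)

theorem gaussTerm_add (m j : ℕ) : gaussTerm (k := k) (j + m) j =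
    X ^ (j ^ 2) * qPoch (X ^ 2) (X ^ 2) (2 * (j + m)) *
    ((qPoch (X ^ 2) (X ^ 2) (2 * j + m))⁻¹ * (qPoch (X ^ 2) (X ^ 2) m)⁻¹) := by
  rw [gaussTerm, if_pos (by omega), show j + m + j = 2 * j + m by ring,
    show j + m - j = m by omega]

theorem qPoch_inv_succ (n : ℕ) : (qPoch (X ^ 2 : k⟦X⟧) (X ^ 2) n)⁻¹ =
    (1 - X ^ (2 * n + 2)) * (qPoch (X ^ 2) (X ^ 2) (n + 1))⁻¹ := by
  rw [qPoch_inv_eq (by simp), show (X : k⟦X⟧) ^ 2 * (X ^ 2) ^ n = X ^ (2 * n + 2) by ring]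

/-- `gaussTerm n j` is the coefficient of `x^j` in `∏_{l<n} (1 + x q^(2l+1))(1 + x⁻¹ q^(2l+1))`. One
more pair of factors is `1 + q^(4n+2) + q^(2n+1)(x + x⁻¹)`, whence the recurrence. -/
theorem gaussTerm_succ_succ {n i : ℕ} (hi : i ≤ n) :
    gaussTerm (k := k) (n + 1) (i + 1) = (1 + X ^ (4 * n + 2)) * gaussTerm n (i + 1) +
      X ^ (2 * n + 1) * (gaussTerm n i + gaussTerm n (i + 2)) := by
  have hP : ∀ n, qPoch (X ^ 2 : k⟦X⟧) (X ^ 2) (2 * (n + 1)) =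
      qPoch (X ^ 2) (X ^ 2) (2 * n) * (1 - X ^ (4 * n + 2)) * (1 - X ^ (4 * n + 4)) := by
    intro n
    rw [show 2 * (n + 1) = 2 * n + 1 + 1 by ring, qPoch_succ, qPoch_succ]
    ring
  obtain ⟨m, rfl⟩ := Nat.exists_eq_add_of_le hi
  rw [show i + m + 1 = i + 1 + m by ring, gaussTerm_add, gaussTerm_add m i,
    show i + 1 + m = i + m + 1 by ring, hP, qPoch_inv_succ (2 * i + m),
    qPoch_inv_succ (2 * i + m + 1), show 2 * (i + 1) + m = 2 * i + m + 1 + 1 by ring]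
  -- For `m = n - i` equal to 0 or 1, some terms on the right lie outside the support and take the
  -- default value 0.
  rcases m with _ | _ | m
  · rw [gaussTerm_of_lt (by omega), gaussTerm_of_lt (by omega)]
    ring
  · rw [gaussTerm_add 0 (i + 1), gaussTerm_of_lt (j := i + 2) (by omega),
      show 2 * (i + 1) + 0 = 2 * i + (0 + 1) + 1 by ring, qPoch_inv_succ (2 * i + (0 + 1) + 1),
      qPoch_inv_succ 0]
    ring
  · rw [show i + (m + 1 + 1) = i + 1 + (m + 1) by ring, gaussTerm_add (m + 1) (i + 1),
      show i + 1 + (m + 1) = i + 2 + m by ring, gaussTerm_add m (i + 2),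
      show 2 * (i + 2) + m = 2 * i + (m + 1 + 1) + 1 + 1 by ring,
      show 2 * (i + 1) + (m + 1) = 2 * i + (m + 1 + 1) + 1 by ring,
      qPoch_inv_succ (2 * i + (m + 1 + 1) + 1), qPoch_inv_succ m, qPoch_inv_succ (m + 1)]
    ring

theorem gaussTerm_succ_zero (n : ℕ) :
    gaussTerm (k := k) (n + 1) 0 = (1 + X ^ (4 * n + 2)) * gaussTerm n 0 +
      2 * X ^ (2 * n + 1) * gaussTerm n 1 := by
  rcases n with _ | n
  · have hP : qPoch (X ^ 2 : k⟦X⟧) (X ^ 2) 2 = (1 - X ^ 2) * (1 - X ^ 4) := by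
      rw [qPoch_succ, qPoch_succ, qPoch_zero]
      ring
    have h1 := qPoch_inv_succ (k := k) 0
    rw [qPoch_zero, inv_one] at h1
    rw [gaussTerm_of_lt (j := 1) (by omega), gaussTerm, gaussTerm, if_pos (by omega),
      if_pos (by omega)]
    simp only [zero_add, mul_zero, Nat.sub_zero, add_zero, mul_one, qPoch_zero, inv_one, hP] at h1 ⊢
    linear_combination (-(1 + X ^ 2) * (1 + (1 - X ^ 2) * (qPoch (X ^ 2) (X ^ 2) 1)⁻¹)) * h1
  · have hP : qPoch (X ^ 2 : k⟦X⟧) (X ^ 2) (2 * (n + 1 + 1)) =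
        qPoch (X ^ 2) (X ^ 2) (2 * (n + 1)) * (1 - X ^ (4 * n + 6)) * (1 - X ^ (4 * n + 8)) := by
      rw [show 2 * (n + 1 + 1) = 2 * (n + 1) + 1 + 1 by ring, qPoch_succ, qPoch_succ]
      ring
    have e0 := gaussTerm_add (k := k) (n + 1) 0
    have e0' := gaussTerm_add (k := k) (n + 1 + 1) 0
    have e1 := gaussTerm_add (k := k) n 1
    simp only [zero_add, mul_zero] at e0 e0'
    rw [add_comm 1 n] at e1
    rw [e0', e0, e1, hP, show 2 * 1 + n = n + 1 + 1 by ring, qPoch_inv_succ (n + 1),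
      qPoch_inv_succ n, qPoch_inv_succ (n + 1)]
    ring

/-- The finite triple product at `x = 1`; the sum over `-n ≤ j ≤ n` is folded by the symmetry `j ↔
-j`, so the central term must be subtracted once. -/
theorem gauss_finite (n : ℕ) :
    qPoch (-X : k⟦X⟧) (X ^ 2) n * qPoch (-X) (X ^ 2) n =
      2 * ∑ j ∈ range (n + 1), gaussTerm n j - gaussTerm n 0 := by
  induction n with
  | zero => simp [gaussTerm, qPoch_zero]; ring
  | succ n ih =>
    have h1 : ∑ i ∈ range (n + 1), gaussTerm (k := k) n (i + 1) =
        ∑ i ∈ range (n + 1), gaussTerm n i - gaussTerm n 0 := by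
      rw [sum_range_succ, gaussTerm_of_lt (by omega), sum_range_succ' _ n]
      ring
    have h2 : ∑ i ∈ range (n + 1), gaussTerm (k := k) n (i + 2) =
        ∑ i ∈ range (n + 1), gaussTerm n i - gaussTerm n 0 - gaussTerm n 1 := by
      rw [← h1, sum_range_succ, gaussTerm_of_lt (by omega), sum_range_succ' _ n]
      ring
    rw [sum_range_succ', sum_congr rfl fun i hi =>
      gaussTerm_succ_succ (by simpa [Nat.lt_succ_iff] using hi)]
    rw [sum_add_distrib, ← mul_sum, ← mul_sum, sum_add_distrib, h1, h2, gaussTerm_succ_zero,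
      qPoch_succ]
    linear_combination ((1 + X ^ (2 * n + 1)) ^ 2) * ih

/-- Gauss' product for `∑ q^{j²}`. -/
theorem gauss_theta :
    qPochInf (-X : k⟦X⟧) (X ^ 2) * qPochInf (-X) (X ^ 2) * qPochInf (X ^ 2) (X ^ 2) =
      2 * infSum (fun j => X ^ (j ^ 2)) - 1 := by
  have hX2 : (X : k⟦X⟧) ∣ X ^ 2 := dvd_pow_self _ two_ne_zero
  have c3 : constantCoeff (qPochInf (X ^ 2 : k⟦X⟧) (X ^ 2)) ≠ 0 := by
    rw [constantCoeff_qPochInf (by simp)]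
    exact one_ne_zero
  have hinv := PowerSeries.mul_inv_cancel _ c3
  have hterm : ∀ j, XAdicLim (fun n => gaussTerm (k := k) n j)
      ((qPochInf (X ^ 2) (X ^ 2))⁻¹ * X ^ (j ^ 2)) := by
    intro j
    have hc : ∀ n, constantCoeff (qPoch (X ^ 2 : k⟦X⟧) (X ^ 2) n) ≠ 0 := fun n => by
      simp [constantCoeff_qPoch_X]
    have h1 := (((qPoch_lim (X ^ 2) hX2).comp (tendsto_of_add_le (φ := fun n => 2 * n) 0
      fun n => by omega)).const_mul (X ^ (j ^ 2))).mul
      ((((qPoch_lim (X ^ 2 : k⟦X⟧) hX2).comp (tendsto_of_add_le (φ := fun n => n + j) 0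
        fun n => by omega)).inv (fun n => hc _) c3).mul
      (((qPoch_lim (X ^ 2) hX2).comp (tendsto_of_add_le (φ := fun n => n - j) j
        fun n => by omega)).inv (fun n => hc _) c3))
    have e : (qPochInf (X ^ 2 : k⟦X⟧) (X ^ 2))⁻¹ * X ^ (j ^ 2) =
        X ^ (j ^ 2) * qPochInf (X ^ 2) (X ^ 2) *
          ((qPochInf (X ^ 2) (X ^ 2))⁻¹ * (qPochInf (X ^ 2) (X ^ 2))⁻¹) := by
      linear_combination (-X ^ (j ^ 2) * (qPochInf (X ^ 2 : k⟦X⟧) (X ^ 2))⁻¹) * hinv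
    rw [e]
    refine h1.congr' ?_
    filter_upwards [eventually_ge_atTop j] with n hn
    rw [gaussTerm, if_pos hn]
  have hsum : XAdicLim (fun n => ∑ j ∈ range (n + 1), gaussTerm (k := k) n j)
      ((qPochInf (X ^ 2) (X ^ 2))⁻¹ * infSum (fun j => X ^ (j ^ 2))) := by
    rw [← infSum_mul_left fun j => pow_dvd_pow _ (Nat.le_self_pow two_ne_zero j)]
    refine XAdicLim.sum_of_dominated (tendsto_add_atTop_nat 1) (fun n j hj => ?_) hterm
    rw [gaussTerm, if_pos (by omega)]
    exact ((pow_dvd_pow _ (Nat.le_self_pow two_ne_zero j)).mul_right _).mul_right _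
  have h1 := (qPoch_lim (-X : k⟦X⟧) hX2).mul (qPoch_lim (-X : k⟦X⟧) hX2)
  have h2 := h1.unique (((hsum.const_mul 2).add ((hterm 0).const_mul (-1))).congr'
    (.of_forall fun n => by rw [gauss_finite]; ring))
  rw [h2]
  simp only [ne_eq, OfNat.ofNat_ne_zero, not_false_eq_true, zero_pow, pow_zero]
  linear_combination (2 * infSum (fun j => (X : k⟦X⟧) ^ (j ^ 2)) - 1) * hinv

theorem coeff_gauss_theta {d : ℕ} (hd : ∀ j, j ^ 2 ≠ d) :
    coeff d (qPochInf (-X : k⟦X⟧) (X ^ 2) * qPochInf (-X) (X ^ 2) *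
      qPochInf (X ^ 2) (X ^ 2)) = 0 := by
  have h0 : d ≠ 0 := fun h => hd 0 (by simp [h])
  rw [gauss_theta, two_mul, map_sub, map_add, coeff_one, if_neg h0, infSum, coeff_mk,
    sum_eq_zero fun j _ => by rw [coeff_X_pow, if_neg (hd j).symm]]
  simp

end Gauss

/-! ### Relations between the mock theta functions. -/

theorem constantCoeff_expand_ne_zero {m : ℕ} (hm : m ≠ 0) {f : k⟦X⟧} (hf : constantCoeff f ≠ 0) :
    constantCoeff (expand m hm f) ≠ 0 := by
  rwa [constantCoeff_expand]

/-- Watson's third order mock theta function `ω`, in Appell–Lerch form. -/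
noncomputable def mockOmega : k⟦X⟧ := (qPochInf (X ^ 2) (X ^ 2))⁻¹ * lambertSum 6 2

/-- The third order mock theta function `ν`, in Appell–Lerch form. -/
noncomputable def mockNu : k⟦X⟧ := (qPochInf X X)⁻¹ * lambertSum 3 (-2)

/-- The analogue of `ν` attached to a primitive fourth root of unity. -/
noncomputable def mockNuQuartic : k⟦X⟧ := (qPochInf X X)⁻¹ * lambertSum 3 0

theorem thetaDenom_two : thetaDenom (2 : k) = qPochInf X (X ^ 2) * qPochInf X (X ^ 2) := by
  have hX2 : (X : k⟦X⟧) ∣ X ^ 2 := dvd_pow_self _ two_ne_zero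
  rw [thetaDenom, qPochInf, ← infProd_mul (X_pow_dvd_factor _ hX2) (X_pow_dvd_factor _ hX2)]
  congr 1
  ext1 l
  rw [quadFactor, map_ofNat]
  ring

theorem thetaDenom_neg_two :
    thetaDenom (-2 : k) = qPochInf (-X) (X ^ 2) * qPochInf (-X) (X ^ 2) := by
  have hX2 : (X : k⟦X⟧) ∣ X ^ 2 := dvd_pow_self _ two_ne_zero
  rw [thetaDenom, qPochInf, ← infProd_mul (X_pow_dvd_factor _ hX2) (X_pow_dvd_factor _ hX2)]
  congr 1
  ext1 l
  rw [quadFactor, map_neg, map_ofNat]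
  ring

theorem thetaDenom_zero :
    thetaDenom (0 : k) = expand 2 two_ne_zero (qPochInf (-X) (X ^ 2)) := by
  have hX2 : (X : k⟦X⟧) ∣ X ^ 2 := dvd_pow_self _ two_ne_zero
  rw [thetaDenom, expand_qPochInf _ hX2, qPochInf]
  congr 1
  ext1 l
  simp only [quadFactor, map_zero, map_neg, map_pow, expand_X]
  ring

section ProductRelations

theorem expand_two_euler :
    expand 2 two_ne_zero (qPochInf (X : k⟦X⟧) X) = qPochInf (X ^ 2) (X ^ 2) := by
  rw [expand_qPochInf _ dvd_rfl, expand_X]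

theorem expand_two_euler_sq :
    expand 2 two_ne_zero (qPochInf (X ^ 2 : k⟦X⟧) (X ^ 2)) = qPochInf (X ^ 4) (X ^ 4) :=
  expand_two_qPochInf_X 2 2 two_ne_zero

theorem euler_eq : qPochInf (X : k⟦X⟧) X = qPochInf X (X ^ 2) * qPochInf (X ^ 2) (X ^ 2) := by
  rw [qPochInf_dissect X dvd_rfl, sq]

theorem odd_mul_neg_odd : qPochInf (X : k⟦X⟧) (X ^ 2) * qPochInf (-X) (X ^ 2) =
    expand 2 two_ne_zero (qPochInf X (X ^ 2)) := by
  have hX2 : (X : k⟦X⟧) ∣ X ^ 2 := dvd_pow_self _ two_ne_zero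
  rw [qPochInf_mul_neg _ hX2, expand_qPochInf _ hX2, map_pow, expand_X]

theorem euler_relation : qPochInf (X : k⟦X⟧) X * qPochInf (X ^ 4) (X ^ 4) * qPochInf (-X) (X ^ 2) =
    qPochInf (X ^ 2) (X ^ 2) * qPochInf (X ^ 2) (X ^ 2) := by
  have h1 := congrArg (expand 2 two_ne_zero) (euler_eq (k := k))
  rw [map_mul, expand_two_euler, expand_two_euler_sq] at h1
  have h2 := odd_mul_neg_odd (k := k)
  rw [euler_eq]
  linear_combination (-qPochInf (X ^ 2 : k⟦X⟧) (X ^ 2)) * h1 +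
    qPochInf (X ^ 2 : k⟦X⟧) (X ^ 2) * qPochInf (X ^ 4) (X ^ 4) * h2

/-- This rewrites the product in `appell_relation` at `u = 0` as a theta series times a series in
`q⁸`, the form on which the argument modulo 8 rests. -/
theorem thetaDenom_zero_relation :
    qPochInf (X ^ 2 : k⟦X⟧) (X ^ 2) * (thetaDenom 0 * expand 2 two_ne_zero (thetaDenom 0)) =
      qPochInf (X ^ 4) (X ^ 4) * expand 2 two_ne_zero (expand 2 two_ne_zero
        (expand 2 two_ne_zero (qPochInf X (X ^ 2)))) := by
  have h1 : qPochInf (X : k⟦X⟧) X * qPochInf (-X) (X ^ 2) =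
      expand 2 two_ne_zero (qPochInf X (X ^ 2) * qPochInf X X) := by
    rw [map_mul, expand_two_euler, ← odd_mul_neg_odd, euler_eq]
    ring
  rw [thetaDenom_zero, ← expand_two_euler_sq, ← expand_two_euler, ← mul_assoc, ← map_mul, h1,
    ← map_mul, ← map_mul, ← map_mul, ← map_mul, ← odd_mul_neg_odd]
  congr 2
  ring

end ProductRelations

theorem appell_relation_aux {K : Type*} [Field K] {j₁ j₂ j₄ p d e L M x : K} (h₁ : j₁ ≠ 0)
    (h₄ : j₄ ≠ 0) (hp : p ≠ 0) (hrel : j₁ * j₄ * p = j₂ * j₂)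
    (h : d⁻¹ * e⁻¹ = (j₂ * j₂ * p)⁻¹ * L + x * (j₄ * j₄ * (p * p))⁻¹ * M) :
    j₁⁻¹ * L = j₄ * p * p * (d⁻¹ * e⁻¹) - x * (j₄⁻¹ * M) := by
  rw [h, ← hrel]
  field_simp
  ring

/-- `theta_partial_fractions` solved for its first sum; `euler_relation` reconciles the two
prefactors. -/
theorem appell_relation (u : k) :
    (qPochInf X X)⁻¹ * lambertSum 3 u =
      qPochInf (X ^ 4) (X ^ 4) * qPochInf (-X) (X ^ 2) * qPochInf (-X) (X ^ 2) *
        ((thetaDenom u)⁻¹ * (expand 2 two_ne_zero (thetaDenom (-u)))⁻¹) -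
      X * expand 2 two_ne_zero ((qPochInf (X ^ 2) (X ^ 2))⁻¹ * lambertSum 6 (-u)) := by
  have c1 : constantCoeff (qPochInf (X : k⟦X⟧) X) ≠ 0 := by
    rw [constantCoeff_qPochInf (by simp)]; exact one_ne_zero
  have c2 : constantCoeff (qPochInf (X ^ 2 : k⟦X⟧) (X ^ 2)) ≠ 0 := by
    rw [constantCoeff_qPochInf (by simp)]; exact one_ne_zero
  have c4 : constantCoeff (qPochInf (X ^ 4 : k⟦X⟧) (X ^ 4)) ≠ 0 := by
    rw [constantCoeff_qPochInf (by simp)]; exact one_ne_zero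
  have cp : constantCoeff (qPochInf (-X : k⟦X⟧) (X ^ 2)) ≠ 0 := by
    rw [constantCoeff_qPochInf (by simp)]; exact one_ne_zero
  have cd : ∀ v : k, constantCoeff (thetaDenom v) ≠ 0 := fun v => by
    rw [constantCoeff_thetaDenom]; exact one_ne_zero
  have key := theta_partial_fractions u
  rw [map_mul, expand_inv 2 two_ne_zero c2, expand_two_euler_sq]
  apply IsFractionRing.injective k⟦X⟧ (FractionRing k⟦X⟧)
  have key' := congrArg (algebraMap k⟦X⟧ (FractionRing k⟦X⟧)) key
  have hrel := congrArg (algebraMap k⟦X⟧ (FractionRing k⟦X⟧)) (euler_relation (k := k))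
  rw [map_mul, map_add, map_mul, map_mul, map_mul] at key'
  rw [algebraMap_fractionRing_inv (cd u),
    algebraMap_fractionRing_inv (constantCoeff_expand_ne_zero two_ne_zero (cd (-u))),
    algebraMap_fractionRing_inv (by simp [c2, cp]),
    algebraMap_fractionRing_inv (by simp [c4, cp])] at key'
  simp only [map_mul] at key' hrel
  simp only [map_sub, map_mul]
  rw [algebraMap_fractionRing_inv c1, algebraMap_fractionRing_inv c4,
    algebraMap_fractionRing_inv (cd u),
    algebraMap_fractionRing_inv (constantCoeff_expand_ne_zero two_ne_zero (cd (-u)))]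
  exact appell_relation_aux (algebraMap_ne_zero_of_constantCoeff c1)
    (algebraMap_ne_zero_of_constantCoeff c4)
    (algebraMap_ne_zero_of_constantCoeff cp) hrel key'

/-- Termwise, with `Q = q^(4j+2)`, this is `(1 - Q)/(1 + Q) = (1 - Q²)/(1 + Q)²`. -/
theorem lambertSum_six_zero :
    lambertSum 6 (0 : k) = expand 2 two_ne_zero (lambertSum 3 (-2)) := by
  rw [lambertSum, lambertSum, expand_infSum (lambertTerm_dvd (by norm_num) _)]
  refine infSum_congr fun j => ?_
  rw [expand_lambertTerm, lambertTerm, show 2 * (3 * (j + 1).choose 2) = 6 * (j + 1).choose 2 by ring]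
  have h0 := PowerSeries.mul_inv_cancel (quadFactor (C (0 : k)) (X ^ (2 * j + 1)))
    (by rw [constantCoeff_quadFactor _ (by omega)]; exact one_ne_zero)
  have h2 := PowerSeries.mul_inv_cancel (quadFactor (C (-2 : k)) (X ^ (2 * (2 * j + 1))))
    (by rw [constantCoeff_quadFactor _ (by omega)]; exact one_ne_zero)
  have e0 : quadFactor (C (0 : k)) (X ^ (2 * j + 1)) = 1 + X ^ (4 * j + 2) := by
    rw [quadFactor, map_zero]; ring
  have e2 : quadFactor (C (-2 : k)) (X ^ (2 * (2 * j + 1))) =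
      (1 + X ^ (4 * j + 2)) * (1 + X ^ (4 * j + 2)) := by
    rw [quadFactor, map_neg, map_ofNat]; ring
  rw [e0] at h0 ⊢
  rw [e2] at h2 ⊢
  rw [PowerSeries.mul_inv_rev] at h2 ⊢
  rw [show 2 * (4 * j + 2) = (4 * j + 2) * 2 by ring, pow_mul X (4 * j + 2) 2]
  linear_combination (-((-1) ^ j * X ^ (6 * (j + 1).choose 2) * (1 - X ^ (4 * j + 2)) *
    (1 + X ^ (4 * j + 2))⁻¹)) * h0

/-- At `u = -2` the factor `(-q;q²)_∞²` cancels against `thetaDenom (-2)`, so the product term is a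
series in `q²` and the odd part comes from `-q ω(q²)` alone. -/
theorem coeff_mockNu_odd (m : ℕ) : coeff (2 * m + 1) (mockNu : k⟦X⟧) = -coeff m mockOmega := by
  have cO : constantCoeff (qPochInf (X : k⟦X⟧) (X ^ 2) * qPochInf X (X ^ 2)) ≠ 0 := by
    rw [map_mul, constantCoeff_qPochInf (by simp), mul_one]; exact one_ne_zero
  have cp : constantCoeff (qPochInf (-X : k⟦X⟧) (X ^ 2) * qPochInf (-X) (X ^ 2)) ≠ 0 := by
    rw [map_mul, constantCoeff_qPochInf (by simp), mul_one]; exact one_ne_zero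
  have h : (mockNu : k⟦X⟧) = expand 2 two_ne_zero
      (qPochInf (X ^ 2) (X ^ 2) * (qPochInf X (X ^ 2) * qPochInf X (X ^ 2))⁻¹) -
      X * expand 2 two_ne_zero mockOmega := by
    rw [mockNu, appell_relation, neg_neg, mockOmega, thetaDenom_neg_two, thetaDenom_two,
      map_mul (expand 2 two_ne_zero) (qPochInf (X ^ 2) (X ^ 2)) (_ * _)⁻¹, expand_two_euler_sq,
      expand_inv _ _ cO]
    linear_combination (qPochInf (X ^ 4) (X ^ 4) * (expand 2 two_ne_zero
      (qPochInf (X : k⟦X⟧) (X ^ 2) * qPochInf X (X ^ 2)))⁻¹) * PowerSeries.mul_inv_cancel _ cp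
  rw [h, map_sub, coeff_succ_X_mul, coeff_expand_of_not_dvd _ _ _ (by omega), coeff_expand_mul]
  ring

theorem mockNuQuartic_eq :
    (mockNuQuartic : k⟦X⟧) = qPochInf (-X) (X ^ 2) * qPochInf (-X) (X ^ 2) *
      qPochInf (X ^ 2) (X ^ 2) * expand 2 two_ne_zero (expand 2 two_ne_zero
        (expand 2 two_ne_zero (qPochInf X (X ^ 2))⁻¹)) -
      X * expand 2 two_ne_zero (expand 2 two_ne_zero mockNu) := by
  have c1 : constantCoeff (qPochInf (X : k⟦X⟧) X) ≠ 0 := by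
    rw [constantCoeff_qPochInf (by simp)]; exact one_ne_zero
  have cO : constantCoeff (qPochInf (X : k⟦X⟧) (X ^ 2)) ≠ 0 := by
    rw [constantCoeff_qPochInf (by simp)]; exact one_ne_zero
  have cO8 : expand 2 two_ne_zero (expand 2 two_ne_zero
        (expand 2 two_ne_zero (qPochInf (X : k⟦X⟧) (X ^ 2)))) * expand 2 two_ne_zero
        (expand 2 two_ne_zero (expand 2 two_ne_zero (qPochInf (X : k⟦X⟧) (X ^ 2))⁻¹)) = 1 := by
    rw [← map_mul, ← map_mul, ← map_mul, PowerSeries.mul_inv_cancel _ cO]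
    simp
  have hD : constantCoeff (thetaDenom (0 : k) * expand 2 two_ne_zero (thetaDenom 0)) ≠ 0 := by
    rw [map_mul, constantCoeff_expand, constantCoeff_thetaDenom, mul_one]; exact one_ne_zero
  have hD' := PowerSeries.mul_inv_cancel _ hD
  rw [mockNuQuartic, appell_relation, neg_zero, lambertSum_six_zero, mockNu,
    map_mul (expand 2 two_ne_zero) (qPochInf X X)⁻¹, expand_inv _ _ c1, expand_two_euler]
  rw [mul_comm (thetaDenom 0)⁻¹, ← PowerSeries.mul_inv_rev]
  set A := qPochInf (-X : k⟦X⟧) (X ^ 2)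
  linear_combination (qPochInf (X ^ 2) (X ^ 2) * A * A * expand 2 two_ne_zero
    (expand 2 two_ne_zero (expand 2 two_ne_zero (qPochInf (X : k⟦X⟧) (X ^ 2))⁻¹))) * hD' -
    (qPochInf (X ^ 4) (X ^ 4) * A * A *
      (thetaDenom (0 : k) * expand 2 two_ne_zero (thetaDenom 0))⁻¹) * cO8 -
    (A * A * (thetaDenom (0 : k) * expand 2 two_ne_zero (thetaDenom 0))⁻¹ * expand 2 two_ne_zero
    (expand 2 two_ne_zero (expand 2 two_ne_zero (qPochInf (X : k⟦X⟧) (X ^ 2))⁻¹))) *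
      thetaDenom_zero_relation (k := k)

/-- In the product term, an exponent congruent to 5 modulo 8 would have to be a square plus a
multiple of 8, which is impossible. The rest is `-q ν(q⁴)` at `4(2m+1) + 1`, and its sign cancels
the one in `coeff_mockNu_odd`. -/
theorem coeff_mockNuQuartic (m : ℕ) :
    coeff (8 * m + 5) (mockNuQuartic : k⟦X⟧) = coeff m mockOmega := by
  rw [mockNuQuartic_eq, map_sub, show 8 * m + 5 = 2 * (2 * (2 * m + 1)) + 1 by ring,
    coeff_succ_X_mul, coeff_expand_mul, coeff_expand_mul, coeff_mockNu_odd, sub_neg_eq_add,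
    add_eq_right, coeff_mul]
  refine sum_eq_zero fun p hp => ?_
  rw [HasAntidiagonal.mem_antidiagonal] at hp
  by_cases h : 8 ∣ p.2
  · obtain ⟨c, hc⟩ := h
    rw [coeff_gauss_theta, zero_mul]
    intro j hj
    have h8 : p.1 % 8 = 5 := by omega
    have : j % 8 < 8 := Nat.mod_lt _ (by norm_num)
    rw [← hj, Nat.pow_mod] at h8
    interval_cases j % 8 <;> simp at h8
  · rw [show coeff p.2 (expand 2 two_ne_zero (expand 2 two_ne_zero
        (expand 2 two_ne_zero (qPochInf (X : k⟦X⟧) (X ^ 2))⁻¹))) = 0 from ?_, mul_zero]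
    rw [← expand_mul, ← expand_mul]
    exact coeff_expand_of_not_dvd _ _ _ (by simpa using h)

/-! ### The Eulerian series for ω. -/

theorem qPoch_succ' {S : Type*} [CommRing S] (c p : S) (n : ℕ) :
    qPoch c p (n + 1) = (1 - c) * qPoch (c * p) p n := by
  rw [qPoch, prod_range_succ', pow_zero, mul_one, mul_comm, qPoch]
  congr 1
  refine prod_congr rfl fun l _ => ?_
  ring

/-- The terms of the two-variable Durfee form of `∑ xⁿ / (y; q²)ₙ₊₁` at `x = q`, `y = q^{2j+1}`. -/
noncomputable def durfeeTerm (j i : ℕ) : k⟦X⟧ :=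
  X ^ (2 * i ^ 2 + i * (2 * j + 2)) * (qPoch X (X ^ 2) (i + 1))⁻¹ *
    (qPoch (X ^ (2 * j + 1)) (X ^ 2) (i + 1))⁻¹

theorem durfeeTerm_dvd (j i : ℕ) : (X : k⟦X⟧) ^ i ∣ durfeeTerm j i :=
  ((pow_dvd_pow _ (by nlinarith)).mul_right _).mul_right _

/-- For `F(y) = ∑ xⁿ/(y;q²)_{n+1}`, removing the factor `1 - y` gives `(1 - y) F(y) = 1 + x F(y
q²)`. Here the same equation is proved for the Durfee form at `x = q`, `y = q^(2j+1)`, by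
telescoping. -/
theorem durfeeTerm_relation (j : ℕ) :
    (1 - X ^ (2 * j + 1)) * infSum (durfeeTerm (k := k) j) =
      1 + X * infSum (durfeeTerm (j + 1)) := by
  have tele : ∀ M, (1 - X ^ (2 * j + 1)) * ∑ i ∈ range M, durfeeTerm (k := k) j i =
      1 + X * ∑ i ∈ range M, durfeeTerm (j + 1) i +
        -(X ^ (2 * M ^ 2 + M * (2 * j + 2)) * (qPoch X (X ^ 2) M)⁻¹ *
          (qPoch (X ^ (2 * j + 3)) (X ^ 2) M)⁻¹) := by
    intro M
    induction M with
    | zero => simp [qPoch_zero]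
    | succ M ih =>
      have c1 : constantCoeff ((1 : k⟦X⟧) - X ^ (2 * j + 1)) ≠ 0 := by simp
      rw [sum_range_succ, sum_range_succ, mul_add, ih, mul_add, durfeeTerm, durfeeTerm,
        qPoch_succ' (X ^ (2 * j + 1)), PowerSeries.mul_inv_rev,
        show (X : k⟦X⟧) ^ (2 * j + 1) * X ^ 2 = X ^ (2 * j + 3) by ring,
        show 2 * (j + 1) + 1 = 2 * j + 3 by ring, qPoch_inv_eq (by simp) _ M,
        qPoch_inv_eq (c := X ^ (2 * j + 3)) (by simp) _ M]
      have h := PowerSeries.mul_inv_cancel _ c1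
      linear_combination (X ^ (2 * M ^ 2 + M * (2 * j + 2)) * (qPoch X (X ^ 2) (M + 1))⁻¹ *
        (1 - X ^ (2 * j + 3) * (X ^ 2) ^ M) *
          (qPoch (X ^ (2 * j + 3) : k⟦X⟧) (X ^ 2) (M + 1))⁻¹) * h
  refine ((infSum_lim (durfeeTerm_dvd j)).const_mul _).unique ?_
  simp_rw [tele]
  rw [← add_zero (1 + _)]
  refine ((XAdicLim.const 1).add ((infSum_lim (durfeeTerm_dvd (j + 1))).const_mul X)).add
    (XAdicLim.zero_of_dvd fun n => ?_)
  exact (((pow_dvd_pow _ (by nlinarith)).mul_right _).mul_right _).neg_right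

/-- Iterating `durfeeTerm_relation` unrolls the Durfee form into the series, with remainder
divisible by `X ^ M`. -/
theorem infSum_durfeeTerm_zero :
    XAdicLim (fun M => ∑ n ∈ range M, X ^ n * (qPoch (X : k⟦X⟧) (X ^ 2) (n + 1))⁻¹)
      (infSum (durfeeTerm 0)) := by
  have key : ∀ M, infSum (durfeeTerm 0) =
      ∑ n ∈ range M, X ^ n * (qPoch (X : k⟦X⟧) (X ^ 2) (n + 1))⁻¹ +
        X ^ M * ((qPoch X (X ^ 2) M)⁻¹ * infSum (durfeeTerm M)) := by
    intro M
    induction M with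
    | zero => simp [qPoch_zero]
    | succ M ih =>
      rw [ih, sum_range_succ, qPoch_inv_eq (by simp) _ M]
      linear_combination (X ^ M * (qPoch (X : k⟦X⟧) (X ^ 2) (M + 1))⁻¹) *
        durfeeTerm_relation (k := k) M
  intro d
  filter_upwards [eventually_ge_atTop d] with n hn
  rw [key n, sub_add_cancel_left, dvd_neg]
  exact (pow_dvd_pow _ hn).mul_right _

/-- At `u = 2` each quadratic factor is `(1 - q^(2l+1))²`, so `watson_whipple` gives ω as `∑
q^(2D(D+1))/(q;q²)_{D+1}²`. -/
theorem mockOmega_eq : (mockOmega : k⟦X⟧) = infSum (durfeeTerm 0) := by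
  refine (watson_whipple (2 : k)).unique ((infSum_lim (durfeeTerm_dvd 0)).congr'
    (.of_forall fun M => sum_congr rfl fun D _ => ?_))
  have e : ∏ l ∈ range (D + 1), quadFactor (C (2 : k)) (X ^ (2 * l + 1)) =
      qPoch X (X ^ 2) (D + 1) * qPoch X (X ^ 2) (D + 1) := by
    rw [qPoch, ← prod_mul_distrib]
    refine prod_congr rfl fun l _ => ?_
    rw [quadFactor, map_ofNat]
    ring
  rw [prod_inv_powerSeries, e, PowerSeries.mul_inv_rev, durfeeTerm, mul_zero, zero_add, pow_one,
    show 4 * (D + 1).choose 2 = 2 * (2 * (D + 1).choose 2) by ring, two_mul_choose_two]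
  ring

theorem mockOmega_lim :
    XAdicLim (fun M => ∑ n ∈ range M, X ^ n * (qPoch (X : k⟦X⟧) (X ^ 2) (n + 1))⁻¹)
      mockOmega := by
  rw [mockOmega_eq]
  exact infSum_durfeeTerm_zero

/-! ### Generating functions of multisets of odd numbers. -/

/-- The multisets of odd numbers less than `2 * D` with sum `n`. -/
def oddMultisets (D n : ℕ) : Finset (Multiset ℕ) :=
  ((univ : Finset n.Partition).image Nat.Partition.parts).filter
    fun s => ∀ a ∈ s, Odd a ∧ a < 2 * D

theorem mem_oddMultisets {D n : ℕ} {s : Multiset ℕ} :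
    s ∈ oddMultisets D n ↔ (∀ a ∈ s, Odd a ∧ a < 2 * D) ∧ s.sum = n := by
  simp only [oddMultisets, mem_filter, Finset.mem_image, Finset.mem_univ, true_and]
  constructor
  · rintro ⟨⟨π, rfl⟩, h⟩
    exact ⟨h, π.parts_sum⟩
  · rintro ⟨h, hs⟩
    exact ⟨⟨⟨s, fun ha => (h _ ha).1.pos, hs⟩, rfl⟩, h⟩

theorem filter_notMem_oddMultisets (D n : ℕ) :
    (oddMultisets (D + 1) n).filter (fun s => 2 * D + 1 ∉ s) = oddMultisets D n := by
  ext s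
  simp only [mem_filter, mem_oddMultisets]
  constructor
  · rintro ⟨⟨h, hs⟩, hn⟩
    refine ⟨fun a ha => ⟨(h a ha).1, ?_⟩, hs⟩
    have h1 := (h a ha).2
    obtain ⟨b, rfl⟩ := (h a ha).1
    have : 2 * b + 1 ≠ 2 * D + 1 := fun e => hn (e ▸ ha)
    omega
  · rintro ⟨h, hs⟩
    refine ⟨⟨fun a ha => ⟨(h a ha).1, ?_⟩, hs⟩, fun hm => ?_⟩
    · have := (h a ha).2
      omega
    · have := (h _ hm).2
      omega

section GeneratingFunction

/-- Either the new largest value `2D + 1` does not occur, or deleting one copy of it lowers the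
cardinality by 1 and the sum by `2D + 1`. -/
theorem sum_oddMultisets_succ (z : R) (D n : ℕ) :
    ∑ s ∈ oddMultisets (D + 1) n, z ^ s.card = ∑ s ∈ oddMultisets D n, z ^ s.card +
      if 2 * D + 1 ≤ n then z * ∑ s ∈ oddMultisets (D + 1) (n - (2 * D + 1)), z ^ s.card else 0 := by
  rw [← sum_filter_add_sum_filter_not _ (fun s => 2 * D + 1 ∉ s), filter_notMem_oddMultisets]
  congr 1
  simp only [not_not]
  split_ifs with h
  · rw [mul_sum]
    refine sum_bij' (fun s _ => s.erase (2 * D + 1)) (fun s _ => (2 * D + 1) ::ₘ s) ?_ ?_ ?_ ?_ ?_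
    · intro s hs
      rw [mem_filter, mem_oddMultisets] at hs
      rw [mem_oddMultisets]
      refine ⟨fun a ha => hs.1.1 a (Multiset.mem_of_mem_erase ha), ?_⟩
      have := Multiset.sum_erase hs.2
      omega
    · intro s hs
      rw [mem_oddMultisets] at hs
      rw [mem_filter, mem_oddMultisets]
      refine ⟨⟨fun a ha => ?_, ?_⟩, Multiset.mem_cons_self _ _⟩
      · rcases Multiset.mem_cons.1 ha with rfl | ha
        · exact ⟨⟨D, rfl⟩, by omega⟩
        · exact hs.1 a ha
      · rw [Multiset.sum_cons, hs.2]
        omega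
    · intro s hs
      exact Multiset.cons_erase (mem_filter.1 hs).2
    · intro s _
      exact Multiset.erase_cons_head _ _
    · intro s hs
      rw [← Multiset.card_erase_add_one (mem_filter.1 hs).2, pow_succ, mul_comm]
  · refine sum_eq_zero fun s hs => ?_
    rw [mem_filter, mem_oddMultisets] at hs
    have := Multiset.le_sum_of_mem hs.2
    omega

/-- The generating function of multisets of odd numbers less than `2 * D`, weighted by
their cardinality. -/
noncomputable def oddGenFun (z : R) (D : ℕ) : R⟦X⟧ :=
  PowerSeries.mk fun n => ∑ s ∈ oddMultisets D n, z ^ s.card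

theorem oddGenFun_zero (z : R) : oddGenFun z 0 = 1 := by
  ext n
  rw [oddGenFun, coeff_mk, coeff_one]
  have h : ∀ s ∈ oddMultisets 0 n, s = 0 := by
    intro s hs
    rw [mem_oddMultisets] at hs
    exact Multiset.eq_zero_of_forall_notMem fun a ha => by have := (hs.1 a ha).2; omega
  split_ifs with hn
  · rw [sum_eq_single 0]
    · simp
    · intro s hs hs0
      exact absurd (h s hs) hs0
    · intro h0
      exact absurd (mem_oddMultisets.2 ⟨by simp, by simp [hn]⟩) h0
  · refine sum_eq_zero fun s hs => ?_
    have h0 := h s hs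
    rw [mem_oddMultisets, h0] at hs
    simp at hs
    omega

theorem oddGenFun_succ (z : R) (D : ℕ) :
    (1 - C z * X ^ (2 * D + 1)) * oddGenFun z (D + 1) = oddGenFun z D := by
  ext n
  rw [sub_mul, one_mul, map_sub, mul_assoc, coeff_C_mul, coeff_X_pow_mul']
  simp only [oddGenFun, coeff_mk]
  rw [sum_oddMultisets_succ]
  split_ifs with h <;> ring

theorem prod_mul_oddGenFun (z : R) (D : ℕ) :
    (∏ l ∈ range D, (1 - C z * X ^ (2 * l + 1))) * oddGenFun z D = 1 := by
  induction D with
  | zero => rw [prod_range_zero, one_mul, oddGenFun_zero]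
  | succ D ih => rw [prod_range_succ, mul_assoc, oddGenFun_succ, ih]

end GeneratingFunction

/-! ### Partitions counted by p_ω. -/

section OmegaPartitions

/-- The parts of the pairs `(i + 1, i)`, for `i` in the multiset `s`. -/
def pairParts (s : Multiset ℕ) : Multiset ℕ :=
  (s.map (fun i => i + 1) + s).filter (fun p => 0 < p)

theorem count_succ_pairParts (s : Multiset ℕ) (p : ℕ) :
    (pairParts s).count (p + 1) = s.count p + s.count (p + 1) := by
  rw [pairParts, Multiset.count_filter_of_pos (show 0 < p + 1 by omega), Multiset.count_add,
    Multiset.count_map_eq_count' _ _ (add_left_injective 1)]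

/-- The multiplicity of `p + 1` among the parts is that of `p` plus that of `p + 1` in `s`, so
multiplicities are recovered downwards from the bound `L`, above which they vanish. -/
theorem pairParts_injective {L : ℕ} {s s' : Multiset ℕ} (hs : ∀ i ∈ s, i < L)
    (hs' : ∀ i ∈ s', i < L) (h : pairParts s = pairParts s') : s = s' := by
  have key : ∀ d p, L ≤ p + d → s.count p = s'.count p := by
    intro d
    induction d with
    | zero =>
      intro p hp
      rw [Multiset.count_eq_zero_of_notMem fun hm => by have := hs p hm; omega,
        Multiset.count_eq_zero_of_notMem fun hm => by have := hs' p hm; omega]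
    | succ d ih =>
      intro p hp
      have h1 := ih (p + 1) (by omega)
      have h2 := congrArg (Multiset.count (p + 1)) h
      rw [count_succ_pairParts, count_succ_pairParts] at h2
      omega
  ext p
  exact key L p (by omega)

theorem sum_filter_pos (s : Multiset ℕ) : (s.filter (fun p => 0 < p)).sum = s.sum := by
  induction s using Multiset.induction_on with
  | empty => rfl
  | cons a s ih =>
    by_cases h : 0 < a
    · rw [Multiset.filter_cons_of_pos _ h, Multiset.sum_cons, Multiset.sum_cons, ih]
    · rw [Multiset.filter_cons_of_neg _ h, Multiset.sum_cons, ih]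
      omega

theorem sum_pairParts (s : Multiset ℕ) :
    (pairParts s).sum = (s.map (fun i => 2 * i + 1)).sum := by
  rw [pairParts, sum_filter_pos]
  induction s using Multiset.induction_on with
  | empty => rfl
  | cons a s ih =>
    simp only [Multiset.map_cons, Multiset.sum_cons, Multiset.sum_add] at ih ⊢
    omega

theorem map_half_odd {D n : ℕ} {t : Multiset ℕ} (ht : t ∈ oddMultisets D n) :
    (t.map (fun a => a / 2)).map (fun i => 2 * i + 1) = t := by
  rw [Multiset.map_map]
  conv_rhs => rw [← Multiset.map_id t]
  refine Multiset.map_congr rfl fun a ha => ?_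
  obtain ⟨b, hb⟩ := ((mem_oddMultisets.1 ht).1 a ha).1
  simp only [Function.comp_apply, id]
  omega

theorem half_lt {D n : ℕ} {t : Multiset ℕ} (ht : t ∈ oddMultisets D n) :
    ∀ i ∈ t.map (fun a => a / 2), i < D := by
  intro i hi
  obtain ⟨a, ha, rfl⟩ := Multiset.mem_map.1 hi
  have := ((mem_oddMultisets.1 ht).1 a ha).2
  omega

theorem le_of_mem_pairParts {D p : ℕ} {s : Multiset ℕ} (hs : ∀ i ∈ s, i < D)
    (hp : p ∈ pairParts s) : p ≤ D := by
  rw [pairParts, Multiset.mem_filter, Multiset.mem_add, Multiset.mem_map] at hp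
  rcases hp.1 with ⟨i, hi, rfl⟩ | hp
  · exact hs i hi
  · exact (hs p hp).le

/-- With largest part `m + 1`, each pair `(i+1, i)` has `i ≤ m` and corresponds to the odd number
`2i + 1 < 2(m+1)` with the same sum. -/
theorem pOmega_eq_sum (n : ℕ) :
    pOmega n = ∑ m ∈ range n, (oddMultisets (m + 1) (n - 1 - m)).card := by
  classical
  rw [pOmega, Nat.card_eq_fintype_card, Fintype.card_subtype, ← card_sigma]
  symm
  have hsum : ∀ x ∈ (range n).sigma (fun m => oddMultisets (m + 1) (n - 1 - m)),
      ((x.1 + 1) ::ₘ pairParts (x.2.map (fun a => a / 2))).sum = n := by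
    rintro ⟨m, t⟩ h
    rw [mem_sigma, mem_range] at h
    rw [Multiset.sum_cons, sum_pairParts, map_half_odd h.2, (mem_oddMultisets.1 h.2).2]
    have := h.1
    simp only at this ⊢
    omega
  refine card_bij (fun x hx => ⟨(x.1 + 1) ::ₘ pairParts (x.2.map (fun a => a / 2)), ?_,
    hsum x hx⟩) ?_ ?_ ?_
  · intro i hi
    rcases Multiset.mem_cons.1 hi with rfl | hi
    · exact Nat.succ_pos _
    · exact (Multiset.mem_filter.1 hi).2
  · rintro ⟨m, t⟩ h
    rw [mem_sigma] at h
    rw [mem_filter]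
    refine ⟨Finset.mem_univ _, m + 1, Multiset.mem_cons_self _ _, fun p hp => ?_,
      t.map (fun a => a / 2), Multiset.erase_cons_head _ _⟩
    rcases Multiset.mem_cons.1 hp with rfl | hp
    · exact le_rfl
    · exact le_of_mem_pairParts (half_lt h.2) hp
  · rintro ⟨m, t⟩ h ⟨m', t'⟩ h' he
    rw [mem_sigma] at h h'
    have hp : (m + 1) ::ₘ pairParts (t.map (fun a => a / 2)) =
        (m' + 1) ::ₘ pairParts (t'.map (fun a => a / 2)) := congrArg Nat.Partition.parts he
    -- The removed part is determined by the partition, because no part of a pair exceeds it.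
    have hle : ∀ {m m' : ℕ} {s s' : Multiset ℕ}, (∀ i ∈ s', i < m' + 1) →
        (m + 1) ::ₘ pairParts s = (m' + 1) ::ₘ pairParts s' → m ≤ m' := by
      intro m m' s s' hs hp
      have : m + 1 ∈ (m' + 1) ::ₘ pairParts s' := hp ▸ Multiset.mem_cons_self _ _
      rcases Multiset.mem_cons.1 this with h | h
      · omega
      · have := le_of_mem_pairParts hs h
        omega
    obtain rfl : m = m' := le_antisymm (hle (half_lt h'.2) hp) (hle (half_lt h.2) hp.symm)
    have := pairParts_injective (half_lt h.2) (half_lt h'.2) ((Multiset.cons_inj_right _).1 hp)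
    have h3 := map_half_odd h.2
    rw [this, map_half_odd h'.2] at h3
    simp only at h3
    rw [h3]
  · rintro π hπ
    obtain ⟨-, L, hL, hmax, s, hs⟩ := mem_filter.1 hπ
    have hs' : π.parts.erase L = pairParts s := hs
    have hL0 : 0 < L := π.parts_pos hL
    have hsum' := Multiset.sum_erase hL
    rw [π.parts_sum, hs', sum_pairParts] at hsum'
    have hlt : ∀ i ∈ s, i < L := by
      intro i hi
      refine hmax (i + 1) (Multiset.mem_of_mem_erase (a := i + 1) (b := L) ?_)
      rw [hs', pairParts, Multiset.mem_filter, Multiset.mem_add]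
      exact ⟨Or.inl (Multiset.mem_map_of_mem _ hi), Nat.succ_pos _⟩
    have hmap : (s.map (fun i => 2 * i + 1)).map (fun a => a / 2) = s := by
      rw [Multiset.map_map]
      conv_rhs => rw [← Multiset.map_id s]
      refine Multiset.map_congr rfl fun a _ => ?_
      simp only [Function.comp_apply, id]
      omega
    refine ⟨⟨L - 1, s.map (fun i => 2 * i + 1)⟩, ?_, ?_⟩
    · rw [mem_sigma, mem_range, mem_oddMultisets]
      refine ⟨by simp only; omega, fun a ha => ?_, by simp only; omega⟩
      obtain ⟨i, hi, rfl⟩ := Multiset.mem_map.1 ha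
      have := hlt i hi
      exact ⟨⟨i, rfl⟩, by simp only; omega⟩
    · apply Nat.Partition.ext
      simp only [hmap]
      rw [← hs', Nat.sub_add_cancel hL0, Multiset.cons_erase hL]

theorem coeff_mockOmega {k : Type*} [Field k] (n : ℕ) (hn : 1 ≤ n) :
    coeff (n - 1) (mockOmega : k⟦X⟧) = (pOmega n : k) := by
  have hgen : ∀ m, (qPoch (X : k⟦X⟧) (X ^ 2) m)⁻¹ = oddGenFun 1 m := by
    intro m
    rw [PowerSeries.inv_eq_iff_mul_eq_one (by simp [constantCoeff_qPoch]),
      ← prod_mul_oddGenFun (1 : k) m, mul_comm, qPoch]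
    congr 1
    refine prod_congr rfl fun l _ => ?_
    rw [map_one]
    ring
  obtain ⟨M, hM, hnM⟩ := ((mockOmega_lim (k := k)).coeff_eventually (n - 1) |>.and
    (eventually_ge_atTop n)).exists
  rw [← hM, map_sum, pOmega_eq_sum, Nat.cast_sum]
  rw [← sum_subset (range_subset_range.2 hnM)]
  · refine sum_congr rfl fun m hm => ?_
    rw [mem_range] at hm
    rw [coeff_X_pow_mul', if_pos (by omega), hgen, oddGenFun, coeff_mk]
    simp
  · intro m _ hm
    rw [mem_range] at hm
    rw [coeff_X_pow_mul', if_neg (by omega)]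

end OmegaPartitions

/-! ### The rank generating function of odd Durfee symbols. -/

section Symbols

/-- Symbols are grouped by subscript: `2D² + 2D = 4 (D+1).choose 2`, the outer `X` supplies the
remaining 1, and the rows contribute independent factors weighted by `z` and `z⁻¹`. The weight
forces `D < n`, so `M ≥ n` loses nothing. -/
theorem sum_zpow_oddRank (z : K) (hz : z ≠ 0) {n M : ℕ} (hM : n ≤ M)
    [Fintype (OddDurfeeSymbol n)] :
    ∑ σ : OddDurfeeSymbol n, z ^ σ.oddRank =
      coeff n (X * ∑ D ∈ range M, X ^ (4 * (D + 1).choose 2) *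
        (oddGenFun z (D + 1) * oddGenFun z⁻¹ (D + 1))) := by
  classical
  have hT := two_mul_choose_two
  rw [← sum_fiberwise_of_maps_to (t := range M) (g := OddDurfeeSymbol.D)
    (fun σ _ => by
      have := σ.weight
      rw [mem_range]
      omega), mul_sum, map_sum]
  refine sum_congr rfl fun D _ => ?_
  rw [← mul_assoc, ← pow_succ', coeff_X_pow_mul']
  split_ifs with h
  · rw [coeff_mul]
    simp only [oddGenFun, coeff_mk, sum_mul_sum]
    simp only [← sum_product']
    rw [sum_sigma']
    refine sum_bij (fun σ _ => ⟨(σ.top.sum, σ.bottom.sum), (σ.top, σ.bottom)⟩) ?_ ?_ ?_ ?_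
    · intro σ hσ
      obtain ⟨-, rfl⟩ := mem_filter.1 hσ
      rw [mem_sigma, HasAntidiagonal.mem_antidiagonal, mem_product, mem_oddMultisets,
        mem_oddMultisets]
      refine ⟨?_, ⟨fun a ha => ⟨σ.top_odd a ha, ?_⟩, rfl⟩, ⟨fun a ha => ⟨σ.bottom_odd a ha, ?_⟩, rfl⟩⟩
      · have h1 := σ.weight
        have h2 := hT σ.D
        simp only
        nlinarith [Nat.sub_add_cancel h]
      · have := σ.top_le a ha
        omega
      · have := σ.bottom_le a ha
        omega
    · intro σ hσ τ hτ he
      obtain ⟨-, hD⟩ := mem_filter.1 hσ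
      obtain ⟨-, hD'⟩ := mem_filter.1 hτ
      simp only [Sigma.mk.injEq, heq_eq_eq, Prod.mk.injEq] at he
      exact OddDurfeeSymbol.ext he.2.1 he.2.2 (hD.trans hD'.symm)
    · rintro ⟨⟨a, b⟩, ⟨s, t⟩⟩ hx
      rw [mem_sigma, HasAntidiagonal.mem_antidiagonal, mem_product, mem_oddMultisets,
        mem_oddMultisets] at hx
      dsimp only at hx
      obtain ⟨hab, ⟨hs, rfl⟩, ⟨ht, rfl⟩⟩ := hx
      refine ⟨⟨s, t, D, fun a ha => (hs a ha).1, fun a ha => ?_, fun a ha => (ht a ha).1,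
        fun a ha => ?_, ?_⟩, ?_, rfl⟩
      · have := (hs a ha).2
        omega
      · have := (ht a ha).2
        omega
      · have h2 := hT D
        nlinarith [Nat.sub_add_cancel h]
      · rw [mem_filter]
        exact ⟨Finset.mem_univ _, rfl⟩
    · intro σ _
      rw [OddDurfeeSymbol.oddRank, zpow_sub₀ hz, zpow_natCast, zpow_natCast, inv_pow,
        div_eq_mul_inv]
  · refine sum_eq_zero fun σ hσ => ?_
    obtain ⟨-, rfl⟩ := mem_filter.1 hσ
    have h1 := σ.weight
    have h2 := hT σ.D
    have h3 : σ.D * (σ.D + 1) = σ.D ^ 2 + σ.D := by ring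
    omega

/-- For `u = z + z⁻¹` the quadratic factor splits as `(1 - z a)(1 - z⁻¹ a)`. -/
theorem prod_quadFactor_inv_eq_oddGenFun (z : K) (hz : z ≠ 0) (D : ℕ) :
    ∏ l ∈ range D, (quadFactor (C (z + z⁻¹)) (X ^ (2 * l + 1) : K⟦X⟧))⁻¹ =
      oddGenFun z D * oddGenFun z⁻¹ D := by
  have e : ∏ l ∈ range D, quadFactor (C (z + z⁻¹)) (X ^ (2 * l + 1) : K⟦X⟧) =
      (∏ l ∈ range D, (1 - C z * X ^ (2 * l + 1))) *
        ∏ l ∈ range D, (1 - C z⁻¹ * X ^ (2 * l + 1)) := by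
    rw [← prod_mul_distrib]
    refine prod_congr rfl fun l _ => ?_
    have h : (C z : K⟦X⟧) * C z⁻¹ = 1 := by rw [← map_mul, mul_inv_cancel₀ hz, map_one]
    rw [quadFactor, map_add]
    linear_combination (-(X ^ (2 * l + 1)) ^ 2) * h
  have h1 := prod_mul_oddGenFun z D
  have h2 := prod_mul_oddGenFun z⁻¹ D
  rw [prod_inv_powerSeries, PowerSeries.inv_eq_iff_mul_eq_one, e]
  · linear_combination ((∏ l ∈ range D, (1 - C z⁻¹ * X ^ (2 * l + 1))) * oddGenFun z⁻¹ D) * h1 + h2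
  · rw [map_prod, prod_eq_one fun l _ => constantCoeff_quadFactor _ (by omega)]
    exact one_ne_zero

theorem sum_zpow_oddRank_eq_coeff (z : K) (hz : z ≠ 0) (n : ℕ)
    [Fintype (OddDurfeeSymbol (n + 1))] :
    ∑ σ : OddDurfeeSymbol (n + 1), z ^ σ.oddRank =
      coeff n ((qPochInf (X ^ 2) (X ^ 2))⁻¹ * lambertSum 6 (z + z⁻¹)) := by
  obtain ⟨M, hM, hnM⟩ := ((watson_whipple (z + z⁻¹)).coeff_eventually n |>.and
    (eventually_ge_atTop (n + 1))).exists
  rw [sum_zpow_oddRank z hz hnM, coeff_succ_X_mul, ← hM]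
  simp only [prod_quadFactor_inv_eq_oddGenFun z hz]

end Symbols

/-! ### Specialisation at a primitive eighth root of unity. -/

/-- With `a = q^(2j+1)` and `u² = 2`, `1/(1 - ua + a²) = (1 + a² + ua)/(1 + a⁴)`; the summand `1 +
a²` gives the even part and `ua` the odd part, which is never needed explicitly. -/
theorem lambertSum_six_even_part {K : Type*} [Field K] {u : K} (hu : u ^ 2 = 2) :
    ∃ R : K⟦X⟧, lambertSum 6 u =
      expand 2 two_ne_zero (lambertSum 3 0) + X * expand 2 two_ne_zero R := by
  have hdvd : ∀ j, (X : K⟦X⟧) ^ j ∣ (-1) ^ j * X ^ (3 * (j + 1).choose 2 + j) *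
      (1 - X ^ (2 * j + 1)) * (quadFactor (C (0 : K)) (X ^ (2 * j + 1)))⁻¹ := fun j =>
    (((pow_dvd_pow _ (by omega)).mul_left _).mul_right _).mul_right _
  have hdvd' : ∀ j, (X : K⟦X⟧) ^ j ∣ expand 2 two_ne_zero ((-1) ^ j *
      X ^ (3 * (j + 1).choose 2 + j) *
      (1 - X ^ (2 * j + 1)) * (quadFactor (C (0 : K)) (X ^ (2 * j + 1)))⁻¹) := by
    intro j
    obtain ⟨c, hc⟩ := hdvd j
    rw [hc, map_mul, map_pow, expand_X, ← pow_mul]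
    exact (pow_dvd_pow _ (by omega)).mul_right _
  -- The odd part `u a (1 - a²)/(1 + a⁴)` rewritten in `q²`: from `a = q (q²)^j` come the outer
  -- factor `X` and the extra exponent `j`.
  refine ⟨C u * infSum fun j => (-1) ^ j * X ^ (3 * (j + 1).choose 2 + j) *
    (1 - X ^ (2 * j + 1)) * (quadFactor (C 0) (X ^ (2 * j + 1)))⁻¹, ?_⟩
  rw [map_mul, expand_C, expand_infSum hdvd, ← mul_assoc, ← infSum_mul_left hdvd', lambertSum,
    lambertSum, expand_infSum (lambertTerm_dvd (by norm_num) _), ← infSum_add]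
  refine infSum_congr fun j => ?_
  have c0 : constantCoeff (quadFactor (C (0 : K)) (X ^ (2 * j + 1))) ≠ 0 := by
    rw [constantCoeff_quadFactor _ (by omega)]; exact one_ne_zero
  have h0 := PowerSeries.mul_inv_cancel (quadFactor (C (0 : K)) (X ^ (2 * (2 * j + 1))))
    (by rw [constantCoeff_quadFactor _ (by omega)]; exact one_ne_zero)
  have hu' := PowerSeries.mul_inv_cancel (quadFactor (C u) (X ^ (2 * j + 1)))
    (by rw [constantCoeff_quadFactor _ (by omega)]; exact one_ne_zero)
  have hC : (C u : K⟦X⟧) ^ 2 = 2 := by rw [← map_pow, hu, map_ofNat]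
  rw [expand_lambertTerm, map_mul, expand_inv _ _ c0, expand_quadFactor, lambertTerm]
  simp only [map_mul, map_sub, map_pow, map_neg, map_one, expand_X]
  have e : quadFactor (C (0 : K)) (X ^ (2 * (2 * j + 1))) =
      quadFactor (C u) (X ^ (2 * j + 1)) * (1 + C u * X ^ (2 * j + 1) + X ^ (4 * j + 2)) := by
    rw [quadFactor, quadFactor, map_zero]
    linear_combination (X ^ (4 * j + 2)) * hC
  set a := (quadFactor (C (0 : K)) (X ^ (2 * (2 * j + 1))))⁻¹
  rw [e] at h0
  have hinv : (quadFactor (C u) (X ^ (2 * j + 1)))⁻¹ =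
      (1 + C u * X ^ (2 * j + 1) + X ^ (4 * j + 2)) * a := by
    linear_combination (-(quadFactor (C u) (X ^ (2 * j + 1)))⁻¹) * h0 +
      ((1 + C u * X ^ (2 * j + 1) + X ^ (4 * j + 2)) * a) * hu'
  rw [hinv]
  ring

/-- A sum of odd numbers has the parity of their number, and `2D² + 2D + 1` is odd, so the two rows
have an even total number of entries when `n` is odd. -/
theorem even_oddRank {n : ℕ} (hn : Odd n) (σ : OddDurfeeSymbol n) : Even σ.oddRank := by
  have h : ∀ s : Multiset ℕ, (∀ a ∈ s, Odd a) → s.sum % 2 = s.card % 2 := by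
    intro s
    induction s using Multiset.induction_on with
    | empty => simp
    | cons a s ih =>
      intro hs
      have h1 := ih fun b hb => hs b (Multiset.mem_cons_of_mem hb)
      obtain ⟨b, hb⟩ := hs a (Multiset.mem_cons_self a s)
      rw [Multiset.sum_cons, Multiset.card_cons]
      omega
  have h1 := h _ σ.top_odd
  have h2 := h _ σ.bottom_odd
  have h3 := σ.weight
  obtain ⟨b, hb⟩ := hn
  rw [OddDurfeeSymbol.oddRank, Int.even_iff]
  omega

theorem re_zpow_of_sq_eq_I {z : ℂ} (hz : z ^ 2 = Complex.I) {r : ℤ} (hr : Even r) :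
    (z ^ r).re = (if r ≡ 0 [ZMOD 8] then 1 else 0) - (if r ≡ 4 [ZMOD 8] then 1 else 0) := by
  obtain ⟨m, rfl⟩ := hr
  have e : z ^ (m + m) = Complex.I ^ (m % 4) := by
    rw [← two_mul, zpow_mul, zpow_ofNat, hz]
    conv_lhs => rw [← Int.mul_ediv_add_emod m 4, zpow_add₀ Complex.I_ne_zero, zpow_mul,
      zpow_ofNat, Complex.I_pow_four, one_zpow, one_mul]
  rw [e]
  have i8 : ∀ a, m + m ≡ a [ZMOD 8] ↔ (m + m) % 8 = a % 8 := fun _ => Iff.rfl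
  have h0 := Int.emod_nonneg m (show (4 : ℤ) ≠ 0 by norm_num)
  have h1 := Int.emod_lt_of_pos m (show (0 : ℤ) < 4 by norm_num)
  generalize hs : m % 4 = s at *
  interval_cases s
  · rw [if_pos ((i8 0).2 (by omega)),
      if_neg (fun h => by have := (i8 4).1 h; omega)]
    simp
  · rw [if_neg (fun h => by have := (i8 0).1 h; omega),
      if_neg (fun h => by have := (i8 4).1 h; omega)]
    simp
  · rw [if_neg (fun h => by have := (i8 0).1 h; omega),
      if_pos ((i8 4).2 (by omega))]
    simp [zpow_ofNat]
  · rw [if_neg (fun h => by have := (i8 0).1 h; omega),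
      if_neg (fun h => by have := (i8 4).1 h; omega), zpow_ofNat, Complex.I_pow_three]
    simp

theorem mainTheorem10 (n : ℕ) (hn : 1 ≤ n) :
    (oddRankCount 0 8 (16 * n - 5) : ℤ) - (oddRankCount 4 8 (16 * n - 5) : ℤ) = (pOmega n : ℤ) := by
  classical
  obtain ⟨m, rfl⟩ := Nat.exists_eq_add_of_le' hn
  rw [show 16 * (m + 1) - 5 = 2 * (8 * m + 5) + 1 by omega]
  let _ : Fintype (OddDurfeeSymbol (2 * (8 * m + 5) + 1)) := Fintype.ofFinite _
  obtain ⟨z, hz⟩ := IsAlgClosed.exists_pow_nat_eq Complex.I (n := 2) two_pos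
  have hz0 : z ≠ 0 := by
    rintro rfl
    exact Complex.I_ne_zero (by rw [← hz]; norm_num)
  have hu : (z + z⁻¹) ^ 2 = 2 := by
    have h4 : z ^ 4 = -1 := by rw [show 4 = 2 * 2 by rfl, pow_mul, hz, Complex.I_sq]
    field_simp
    linear_combination h4
  obtain ⟨R, hR⟩ := lambertSum_six_even_part hu
  have c1 : constantCoeff (qPochInf (X : ℂ⟦X⟧) X) ≠ 0 := by
    rw [constantCoeff_qPochInf (by simp)]; exact one_ne_zero
  have hsplit : (qPochInf (X ^ 2 : ℂ⟦X⟧) (X ^ 2))⁻¹ * lambertSum 6 (z + z⁻¹) =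
      expand 2 two_ne_zero mockNuQuartic +
        X * expand 2 two_ne_zero ((qPochInf (X : ℂ⟦X⟧) X)⁻¹ * R) := by
    rw [hR, mockNuQuartic, map_mul, map_mul, expand_inv _ _ c1, expand_two_euler]
    ring
  have key : ∑ σ : OddDurfeeSymbol (2 * (8 * m + 5) + 1), z ^ σ.oddRank = (pOmega (m + 1) : ℂ) := by
    rw [sum_zpow_oddRank_eq_coeff z hz0, hsplit, map_add, coeff_expand_mul, coeff_mockNuQuartic,
      show 2 * (8 * m + 5) = 2 * (8 * m + 4) + 1 + 1 by ring, coeff_succ_X_mul,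
      coeff_expand_of_not_dvd _ _ _ (by omega), add_zero, ← coeff_mockOmega (m + 1) hn,
      Nat.add_sub_cancel]
  -- Taking real parts discards ranks congruent to 2 or 6 modulo 8, where `z^rank = ±i`.
  have hre := congrArg Complex.re key
  rw [Complex.re_sum, Complex.natCast_re, sum_congr rfl fun σ _ =>
    re_zpow_of_sq_eq_I hz (even_oddRank ⟨_, rfl⟩ σ), sum_sub_distrib, sum_boole, sum_boole] at hre
  rw [oddRankCount, oddRankCount, Nat.card_eq_fintype_card, Nat.card_eq_fintype_card,
    Fintype.card_subtype, Fintype.card_subtype]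
  exact_mod_cast hre
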